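/- Let $\mathcal M$ be a compact Riemannian manifold (possibly with boundary or corners) of dimension $m$, let $\mathcal N$ be a compact Riemannian manifold without boundary, and let $\pi:\widetilde{\mathcal N}\to\mathcal N$ be a Riemannian covering map, that is, a covering map (not necessarily surjective) from a Riemannian manifold $\widetilde{\mathcal N}$ which is smooth and preserves the metric tensor. Denote by $d_{\mathcal M}$, $d_{\mathcal N}$, $d_{\widetilde{\mathcal N}}$ the geodesic distances (equal to $+\infty$ between points of different connected components, with the conventions $a/\infty=0$ for all $a\in[0,\infty]$, and $0/0=0$), by $\mathrm{inj}(\mathcal N)$ the injectivity radius of $\mathcal N$, and by $\mathrm{d}x$, $\mathrm{d}y$ integration with respect to the Riemannian volume of $\mathcal M$. Let $s\in(0,1)$ and $p\in(1,\infty)$ be such that $sp>1$. Let $X(\mathcal M,\widetilde{\mathcal N})$ be the set of measurable maps $\tilde u:\mathcal M\to\widetilde{\mathcal N}$ such that $$\iint_{\{(x,y)\in\mathcal M\times\mathcal M\,:\,d_{\widetilde{\mathcal N}}(\tilde u(x),\tilde u(y))\ge \mathrm{inj}(\mathcal N)/2\}}\frac{1}{d_{\mathcal M}(x,y)^{m+1}}\,\mathrm{d}y\,\mathrm{d}x<\infty,$$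 and let $\dot W^{s,p}(\mathcal M,\mathcal N)$ be the set of measurable maps $u:\mathcal M\to\mathcal N$ such that $$\iint_{\mathcal M\times\mathcal M}\frac{d_{\mathcal N}(u(y),u(x))^p}{d_{\mathcal M}(y,x)^{m+sp}}\,\mathrm{d}y\,\mathrm{d}x<\infty.$$ Then there exists a constant $C\in(0,\infty)$, which does not depend on $\tilde u$, such that for every $\tilde u\in X(\mathcal M,\widetilde{\mathcal N})$ for which $u:=\pi\circ\tilde u$ belongs to $\dot W^{s,p}(\mathcal M,\mathcal N)$, $$\iint_{\mathcal M\times\mathcal M}\frac{\min\{d_{\widetilde{\mathcal N}}(\tilde u(y),\tilde u(x))^p,\,1\}}{d_{\mathcal M}(y,x)^{m+sp}}\,\mathrm{d}y\,\mathrm{d}x\le C\iint_{\mathcal M\times\mathcal M}\frac{d_{\mathcal N}(u(y),u(x))^p}{d_{\mathcal M}(y,x)^{m+sp}}\,\mathrm{d}y\,\mathrm{d}x.$$ -/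

import Mathlib

open Set MeasureTheory Manifold Bundle
open scoped ENNReal NNReal ContDiff

/-! ### Geodesics and the injectivity radius

Distances are geodesic distances with values in `[0, ∞]` (they are `∞` between different connected
components), so geodesics and cut points can be described in terms of `edist`. -/

section Injectivity

variable {X : Type*} [EMetricSpace X]

/-- `γ : [0, ℓ] → X` is a unit-speed geodesic: a curve parametrized by arc-length that is locally
length-minimizing. On a Riemannian manifold without boundary whose geodesic distance is `edist`,
these are exactly the unit-speed solutions of the geodesic equation. -/
def IsUnitSpeedGeodesic (γ : ℝ → X) (ℓ : ℝ) : Prop :=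
  ∀ t ∈ Icc 0 ℓ, ∃ ε > 0, ∀ a ∈ Icc 0 ℓ, ∀ b ∈ Icc 0 ℓ, |a - t| < ε → |b - t| < ε →
    edist (γ a) (γ b) = ENNReal.ofReal |a - b|

variable (X) in
/-- The injectivity radius of a complete Riemannian manifold, as the infimum over all points of
the distance to the cut locus. A unit-speed geodesic starting at `x` minimizes the distance to `x`
exactly until it reaches its cut point, so this is the infimum of the lengths of the
unit-speed geodesics that are not minimizing (`∞` if there are none). -/
noncomputable def injectivityRadius : ℝ≥0∞ :=
  sInf {r | ∃ (ℓ : ℝ) (γ : ℝ → X), 0 ≤ ℓ ∧ IsUnitSpeedGeodesic γ ℓ ∧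
    edist (γ 0) (γ ℓ) < ENNReal.ofReal ℓ ∧ r = ENNReal.ofReal ℓ}

end Injectivity

/-! ### Riemannian coverings -/

section Covering

variable {n : ℕ}
  {N : Type*} [EMetricSpace N] [ChartedSpace (EuclideanSpace ℝ (Fin n)) N]
  [RiemannianBundle (fun y : N ↦ TangentSpace (𝓡 n) y)]
  {N' : Type*} [EMetricSpace N'] [ChartedSpace (EuclideanSpace ℝ (Fin n)) N']
  [RiemannianBundle (fun y : N' ↦ TangentSpace (𝓡 n) y)]

variable (n) in
/-- A Riemannian covering: a smooth covering map (not necessarily surjective) that preserves the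
metric tensor. -/
structure IsRiemannianCovering (proj : N' → N) : Prop where
  isCoveringMap : IsCoveringMap proj
  contMDiff : ContMDiff (𝓡 n) (𝓡 n) ∞ proj
  inner_mfderiv : ∀ (y : N') (v w : TangentSpace (𝓡 n) y),
    inner ℝ (mfderiv (𝓡 n) (𝓡 n) proj y v) (mfderiv (𝓡 n) (𝓡 n) proj y w) = inner ℝ v w

end Covering

/-! ### Fractional energies on an `m`-dimensional Riemannian manifold

The Riemannian volume of an `m`-dimensional Riemannian manifold `M` is the `m`-dimensional
Hausdorff measure of its geodesic distance, normalized to be Lebesgue measure on `ℝ^m`: this is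
`μHE[m]`. In the integrands below, the conventions of `ℝ≥0∞` give `0 / 0 = 0` on the diagonal and
`a / ∞ = 0` for pairs of points of `M` in different connected components. -/

section Energy

variable {M : Type*} [EMetricSpace M] [MeasurableSpace M] [BorelSpace M]

/-- The Gagliardo energy `∬ d(u(y), u(x))^p / d(y, x)^(m + sp) dy dx`. -/
noncomputable def gagliardoEnergy {Y : Type*} [EMetricSpace Y] (m : ℕ) (s p : ℝ) (u : M → Y) :
    ℝ≥0∞ :=
  ∫⁻ x, ∫⁻ y, edist (u y) (u x) ^ p / edist y x ^ ((m : ℝ) + s * p) ∂μHE[m] ∂μHE[m]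

/-- The truncated energy `∬ (d(u(y), u(x))^p ∧ 1) / d(y, x)^(m + sp) dy dx`. -/
noncomputable def truncatedEnergy {Y : Type*} [EMetricSpace Y] (m : ℕ) (s p : ℝ) (u : M → Y) :
    ℝ≥0∞ :=
  ∫⁻ x, ∫⁻ y, min (edist (u y) (u x) ^ p) 1 / edist y x ^ ((m : ℝ) + s * p) ∂μHE[m] ∂μHE[m]

/-- Membership in the homogeneous fractional Sobolev space `Ẇ^{s,p}(M, Y)`, `m = dim M`. -/
def MemFracSobolev {Y : Type*} [EMetricSpace Y] [MeasurableSpace Y] (m : ℕ) (s p : ℝ)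
    (u : M → Y) : Prop :=
  AEMeasurable u μHE[m] ∧ gagliardoEnergy m s p u < ⊤

variable (N : Type*) [EMetricSpace N] {N' : Type*} [EMetricSpace N'] [MeasurableSpace N']

/-- Membership in the space `X(M, N')`, `m = dim M`, for a covering space `N'` of `N`: the map
`u : M → N'` is (Lebesgue) measurable and
`∬_{d(u(x), u(y)) ≥ inj(N) / 2} 1 / d(x, y)^(m + 1) dy dx < ⊤`. -/
def MemLiftingSpace (m : ℕ) (u : M → N') : Prop :=
  AEMeasurable u μHE[m] ∧
    ∫⁻ x, ∫⁻ y in {y | injectivityRadius N / 2 ≤ edist (u x) (u y)},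
      1 / edist x y ^ ((m : ℝ) + 1) ∂μHE[m] ∂μHE[m] < ⊤

end Energy

/-! ### A fractional estimate on convex sets -/

section ConvexEstimate

open Module Filter Topology

variable {E : Type*} [NormedAddCommGroup E] [NormedSpace ℝ E] [MeasurableSpace E] [BorelSpace E]
  [FiniteDimensional ℝ E] {μ : Measure E} [μ.IsAddHaarMeasure]

/-! Below the injectivity radius of the base, a Riemannian covering of a compact manifold preserves
distances (`IsRiemannianCovering.edist_eq_of_lt_injectivityRadius`): a minimizing geodesic upstairs
projects to a geodesic downstairs, which is still minimizing if it is short. Put r =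
`injectivityRadius N / 2`. Pairs across which the lift moves by less than r contribute at most the
Gagliardo energy of the projection, so it remains to integrate the kernel over the set B of pairs
across which the lift jumps by at least r.

On a convex set, cut the segment from x to y at its midpoint: if (x, y) is in B, one of the halves
is in B or in the set D of pairs with increment in [r/2, r). Writing J_B(w) for the measure of the x
with (x, x + w) in B, this gives J_B(w) ≤ 2 J_B(w/2) + 2 J_D(w/2). Iteration leaves a remainder 2^k
J_B(w/2^k), whose lower limit vanishes for almost every w thanks to the integrability defining the
lifting space, plus a sum of J_D over dyadic scales. Against the weight |w|^(-(m + sp)) that sum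
becomes a geometric series of ratio 2^(1 - sp), convergent since sp > 1
(`lintegral_indicator_div_edist_le`). On D the increments of the lift and of its projection coincide
and are at least r/2, so the integral over D is bounded by the energy. Bi-Lipschitz charts carry
this to small patches of M (`IsConvexPatch.exists_lintegral_le`).

Away from the diagonal the kernel is bounded, and the truncated power of the distance satisfies a
quasi-triangle inequality, so local bounds chain along connected sets; compactness of M × M leaves
finitely many constants (`exists_truncatedEnergy_le`). -/

/-- The measure of the set of points `x` of `U` such that `x + w` lies in `U` and `(x, x + w)`
lies in `S`. -/
noncomputable def incrementMass (μ : Measure E) (U : Set E) (S : Set (E × E)) (w : E) : ℝ≥0∞ :=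
  μ {x | x ∈ U ∧ x + w ∈ U ∧ (x, x + w) ∈ S}

lemma measurableSet_increment {U : Set E} {S : Set (E × E)} (hU : MeasurableSet U)
    (hS : MeasurableSet S) :
    MeasurableSet {z : E × E | z.2 ∈ U ∧ z.2 + z.1 ∈ U ∧ (z.2, z.2 + z.1) ∈ S} := by
  refine (measurable_snd hU).inter (((measurable_snd.add measurable_fst) hU).inter ?_)
  exact (measurable_snd.prodMk (measurable_snd.add measurable_fst)) hS

lemma measurable_incrementMass {U : Set E} {S : Set (E × E)} (hU : MeasurableSet U)
    (hS : MeasurableSet S) : Measurable (incrementMass μ U S) :=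
  measurable_measure_prodMk_left (measurableSet_increment hU hS)

/-- Substitute y = x + w and exchange the integrals: the weight depends on the increment only, so
all information on `S` is in `incrementMass`. -/
lemma lintegral_lintegral_indicator_eq_incrementMass {U : Set E} {S : Set (E × E)}
    (hU : MeasurableSet U) (hS : MeasurableSet S) {k : E → ℝ≥0∞} (hk : Measurable k) :
    ∫⁻ x in U, ∫⁻ y in U, S.indicator 1 (x, y) * k (y - x) ∂μ ∂μ
      = ∫⁻ w, incrementMass μ U S w * k w ∂μ := by
  have h1 : ∀ x, U.indicator (fun x ↦ ∫⁻ y in U, S.indicator 1 (x, y) * k (y - x) ∂μ) x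
      = ∫⁻ w, {z : E × E | z.2 ∈ U ∧ z.2 + z.1 ∈ U ∧ (z.2, z.2 + z.1) ∈ S}.indicator 1 (w, x)
          * k w ∂μ := by
    intro x
    by_cases hx : x ∈ U
    · rw [indicator_of_mem hx, ← lintegral_indicator hU, ← lintegral_add_left_eq_self _ x]
      refine lintegral_congr fun w ↦ ?_
      by_cases h2 : x + w ∈ U <;> by_cases h3 : (x, x + w) ∈ S <;> simp [h2, h3, hx]
    · simp [hx]
  rw [← lintegral_indicator hU, lintegral_congr h1, lintegral_lintegral_swap]
  · refine lintegral_congr fun w ↦ ?_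
    rw [lintegral_mul_const]
    · congr 1
      have hm : MeasurableSet {x | x ∈ U ∧ x + w ∈ U ∧ (x, x + w) ∈ S} :=
        measurable_prodMk_left (measurableSet_increment hU hS)
      rw [incrementMass, ← lintegral_indicator_one hm]
      rfl
    · exact (measurable_one.indicator (measurableSet_increment hU hS)).comp measurable_prodMk_left
  · refine Measurable.aemeasurable ?_
    exact ((measurable_one.indicator (measurableSet_increment hU hS)).comp measurable_swap).mul
      (hk.comp measurable_snd)

omit [FiniteDimensional ℝ E] in
/-- The midpoint inequality for `incrementMass`. -/
lemma incrementMass_le_two_mul {U : Set E} (hU : Convex ℝ U) {B D : Set (E × E)}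
    (hmid : ∀ x ∈ U, ∀ y ∈ U, (x, y) ∈ B →
      (x, midpoint ℝ x y) ∈ B ∪ D ∨ (midpoint ℝ x y, y) ∈ B ∪ D) (w : E) :
    incrementMass μ U B w ≤ 2 * incrementMass μ U B ((1 / 2 : ℝ) • w)
      + 2 * incrementMass μ U D ((1 / 2 : ℝ) • w) := by
  set v : E := (1 / 2 : ℝ) • w with hv
  have hvw : v + v = w := by rw [hv, ← add_smul]; norm_num
  -- Both halves of the segment have the same increment v; the second starts at x + v, and
  -- translation invariance removes that shift.
  have hsub : {x | x ∈ U ∧ x + w ∈ U ∧ (x, x + w) ∈ B} ⊆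
      ({x | x ∈ U ∧ x + v ∈ U ∧ (x, x + v) ∈ B} ∪ {x | x ∈ U ∧ x + v ∈ U ∧ (x, x + v) ∈ D}) ∪
      ((fun x ↦ x + v) ⁻¹' {x | x ∈ U ∧ x + v ∈ U ∧ (x, x + v) ∈ B} ∪
        (fun x ↦ x + v) ⁻¹' {x | x ∈ U ∧ x + v ∈ U ∧ (x, x + v) ∈ D}) := by
    rintro x ⟨hx, hxw, hB⟩
    have hmp : midpoint ℝ x (x + w) = x + v := by
      rw [midpoint_eq_smul_add, ← hvw]
      rw [show x + (x + (v + v)) = (2 : ℝ) • (x + v) by rw [two_smul]; abel, smul_smul]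
      norm_num
    have hxv : x + v ∈ U := by
      rw [← hmp]; exact hU.midpoint_mem hx hxw
    have hw' : x + v + v = x + w := by rw [add_assoc, hvw]
    have := hmid x hx _ hxw hB
    rw [hmp] at this
    rcases this with (h | h) | (h | h)
    · exact Or.inl (Or.inl ⟨hx, hxv, h⟩)
    · exact Or.inl (Or.inr ⟨hx, hxv, h⟩)
    · refine Or.inr (Or.inl ⟨hxv, ?_, ?_⟩) <;> simpa only [hw']
    · refine Or.inr (Or.inr ⟨hxv, ?_, ?_⟩) <;> simpa only [hw']
  refine (measure_mono hsub).trans ((measure_union_le _ _).trans ?_)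
  refine (add_le_add (measure_union_le _ _) (measure_union_le _ _)).trans ?_
  rw [measure_preimage_add_right, measure_preimage_add_right]
  simp only [incrementMass]
  rw [two_mul, two_mul]
  apply le_of_eq; abel

omit [FiniteDimensional ℝ E] in
lemma incrementMass_le_pow_mul_add_tsum {U : Set E} (hU : Convex ℝ U) {B D : Set (E × E)}
    (hmid : ∀ x ∈ U, ∀ y ∈ U, (x, y) ∈ B →
      (x, midpoint ℝ x y) ∈ B ∪ D ∨ (midpoint ℝ x y, y) ∈ B ∪ D) (w : E) (k : ℕ) :
    incrementMass μ U B w ≤ 2 ^ k * incrementMass μ U B ((1 / 2 : ℝ) ^ k • w)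
      + ∑' j : ℕ, 2 ^ (j + 1) * incrementMass μ U D ((1 / 2 : ℝ) ^ (j + 1) • w) := by
  have key : incrementMass μ U B w ≤ 2 ^ k * incrementMass μ U B ((1 / 2 : ℝ) ^ k • w)
      + ∑ j ∈ Finset.range k,
        2 ^ (j + 1) * incrementMass μ U D ((1 / 2 : ℝ) ^ (j + 1) • w) := by
    induction k with
    | zero => simp
    | succ k ih =>
      refine ih.trans ?_
      have h := incrementMass_le_two_mul (μ := μ) hU hmid ((1 / 2 : ℝ) ^ k • w)
      rw [smul_smul, ← pow_succ'] at h
      rw [Finset.sum_range_succ]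
      calc _ ≤ 2 ^ k * (2 * incrementMass μ U B ((1 / 2 : ℝ) ^ (k + 1) • w)
            + 2 * incrementMass μ U D ((1 / 2 : ℝ) ^ (k + 1) • w)) + _ := by gcongr
        _ = _ := by rw [pow_succ (2 : ℝ≥0∞) k]; ring
  exact key.trans (add_le_add le_rfl (ENNReal.sum_le_tsum _))

lemma lintegral_comp_smul_haar (f : E → ℝ≥0∞) {r : ℝ} (hr : 0 < r) :
    ∫⁻ w, f (r • w) ∂μ = (ENNReal.ofReal r ^ (finrank ℝ E : ℝ))⁻¹ * ∫⁻ w, f w ∂μ := by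
  have h := lintegral_map_equiv (μ := μ) f
    (Homeomorph.smulOfNeZero r hr.ne').toMeasurableEquiv
  have h2 : Measure.map ((Homeomorph.smulOfNeZero (α := E) r hr.ne').toMeasurableEquiv) μ
      = ENNReal.ofReal |(r ^ finrank ℝ E)⁻¹| • μ := Measure.map_addHaar_smul μ hr.ne'
  rw [h2, lintegral_smul_measure] at h
  rw [smul_eq_mul] at h
  have h3 : ENNReal.ofReal |(r ^ finrank ℝ E)⁻¹|
      = (ENNReal.ofReal r ^ (finrank ℝ E : ℝ))⁻¹ := by
    rw [abs_of_nonneg (by positivity), ENNReal.ofReal_inv_of_pos (by positivity),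
      ENNReal.rpow_natCast, ENNReal.ofReal_pow hr.le]
  rw [← h3, h]
  rfl

/-- Scaling of a weighted integral with a homogeneous weight. -/
lemma lintegral_comp_smul_mul_inv_rpow (g : E → ℝ≥0∞) {r : ℝ} (hr : 0 < r) {q : ℝ}
    (hq : 0 < q) :
    ∫⁻ w, g (r • w) * (‖w‖ₑ ^ ((finrank ℝ E : ℝ) + q))⁻¹ ∂μ
      = ENNReal.ofReal r ^ q * ∫⁻ w, g w * (‖w‖ₑ ^ ((finrank ℝ E : ℝ) + q))⁻¹ ∂μ := by
  set d : ℝ := (finrank ℝ E : ℝ) with hd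
  have hd0 : 0 ≤ d := by positivity
  have hα : 0 < d + q := by positivity
  have hr0 : ENNReal.ofReal r ≠ 0 := by simpa using hr
  have hrt : ENNReal.ofReal r ≠ ⊤ := ENNReal.ofReal_ne_top
  have hr1 : ENNReal.ofReal r ^ (d + q) ≠ 0 := by simp [hr, hrt]
  have hr2 : ENNReal.ofReal r ^ (d + q) ≠ ⊤ := ENNReal.rpow_ne_top_of_nonneg hα.le hrt
  have h1 : ∀ w : E, g (r • w) * (‖w‖ₑ ^ (d + q))⁻¹
      = ENNReal.ofReal r ^ (d + q) * (g (r • w) * (‖r • w‖ₑ ^ (d + q))⁻¹) := by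
    intro w
    rw [enorm_smul, Real.enorm_of_nonneg hr.le, ENNReal.mul_rpow_of_nonneg _ _ hα.le,
      ENNReal.mul_inv (Or.inl hr1) (Or.inl hr2)]
    calc _ = (ENNReal.ofReal r ^ (d + q) * (ENNReal.ofReal r ^ (d + q))⁻¹) *
          (g (r • w) * (‖w‖ₑ ^ (d + q))⁻¹) := by rw [ENNReal.mul_inv_cancel hr1 hr2, one_mul]
      _ = _ := by ring
  simp_rw [h1]
  rw [lintegral_const_mul' _ _ hr2,
    lintegral_comp_smul_haar (μ := μ) (fun w ↦ g w * (‖w‖ₑ ^ (d + q))⁻¹) hr, ← mul_assoc]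
  congr 1
  rw [ENNReal.rpow_add _ _ hr0 hrt, mul_comm, ← mul_assoc, ENNReal.inv_mul_cancel, one_mul]
  · simp [hr]
  · exact ENNReal.rpow_ne_top_of_nonneg hd0 hrt

/-- If the mass of the increments in `B` decays sufficiently at the origin, it is controlled by
the masses of the increments in `D` at smaller scales. -/
lemma ae_incrementMass_le_tsum [Nontrivial E] {U : Set E} (hU : Convex ℝ U)
    (hUm : MeasurableSet U) {B D : Set (E × E)} (hB : MeasurableSet B)
    (hmid : ∀ x ∈ U, ∀ y ∈ U, (x, y) ∈ B →
      (x, midpoint ℝ x y) ∈ B ∪ D ∨ (midpoint ℝ x y, y) ∈ B ∪ D)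
    (hfin : ∫⁻ w, incrementMass μ U B w * (‖w‖ₑ ^ ((finrank ℝ E : ℝ) + 1))⁻¹ ∂μ ≠ ⊤) :
    ∀ᵐ w ∂μ, incrementMass μ U B w
      ≤ ∑' j : ℕ, 2 ^ (j + 1) * incrementMass μ U D ((1 / 2 : ℝ) ^ (j + 1) • w) := by
  set d : ℝ := (finrank ℝ E : ℝ) with hd
  have hd0 : 0 ≤ d := by positivity
  set κ : E → ℝ≥0∞ := fun w ↦ (‖w‖ₑ ^ (d + 1))⁻¹ with hκ
  have hJm : Measurable (incrementMass μ U B) := measurable_incrementMass hUm hB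
  have hκm : Measurable κ := by fun_prop
  have main : ∀ R : ℕ, ∀ᵐ w ∂μ, w ∈ Metric.ball (0 : E) R → incrementMass μ U B w
      ≤ ∑' j : ℕ, 2 ^ (j + 1) * incrementMass μ U D ((1 / 2 : ℝ) ^ (j + 1) • w) := by
    intro R
    rw [← ae_restrict_iff' Metric.isOpen_ball.measurableSet]
    -- The weighted remainder of the dyadic iteration. The exponent d + 1 is the one for which the
    -- dilation by 2^(-k) absorbs the factor 2^k, so the integral of `f k` over a ball is that of
    -- one fixed integrable function over a ball shrunk by 2^(-k).
    set f : ℕ → E → ℝ≥0∞ := fun k w ↦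
      2 ^ k * (incrementMass μ U B ((1 / 2 : ℝ) ^ k • w) * κ w) with hf
    have hfm : ∀ k, Measurable (f k) := fun k ↦
      (((hJm.comp (measurable_const_smul _)).mul hκm).const_mul _)
    have hint : ∀ k, ∫⁻ w in Metric.ball (0 : E) R, f k w ∂μ
        = ∫⁻ w in Metric.ball (0 : E) ((1 / 2) ^ k * R), incrementMass μ U B w * κ w ∂μ := by
      intro k
      have hk : (0 : ℝ) < (1 / 2) ^ k := by positivity
      have h := lintegral_comp_smul_mul_inv_rpow (μ := μ)
        ((Metric.ball (0 : E) ((1 / 2) ^ k * R)).indicator (incrementMass μ U B)) hk one_pos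
      rw [← lintegral_indicator Metric.isOpen_ball.measurableSet,
        ← lintegral_indicator Metric.isOpen_ball.measurableSet]
      have e1 : ∀ w, (Metric.ball (0 : E) R).indicator (f k) w = 2 ^ k *
          ((Metric.ball (0 : E) ((1 / 2) ^ k * R)).indicator (incrementMass μ U B)
            ((1 / 2 : ℝ) ^ k • w) * (‖w‖ₑ ^ (d + 1))⁻¹) := by
        intro w
        have : (1 / 2 : ℝ) ^ k • w ∈ Metric.ball (0 : E) ((1 / 2) ^ k * R)
            ↔ w ∈ Metric.ball (0 : E) R := by
          rw [mem_ball_zero_iff, mem_ball_zero_iff, norm_smul, Real.norm_of_nonneg hk.le,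
            mul_lt_mul_iff_right₀ hk]
        by_cases hw : w ∈ Metric.ball (0 : E) R
        · rw [indicator_of_mem hw, indicator_of_mem (this.2 hw)]
        · rw [indicator_of_notMem hw, indicator_of_notMem (fun h ↦ hw (this.1 h))]; simp
      rw [lintegral_congr e1, lintegral_const_mul' _ _ (by simp), h, ← mul_assoc]
      have : (2 : ℝ≥0∞) ^ k * ENNReal.ofReal ((1 / 2) ^ k) ^ (1 : ℝ) = 1 := by
        rw [ENNReal.rpow_one, ← ENNReal.ofReal_ofNat 2, ← ENNReal.ofReal_pow (by norm_num),
          ← ENNReal.ofReal_mul (by positivity), ← mul_pow]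
        norm_num
      rw [this, one_mul]
      refine lintegral_congr fun w ↦ ?_
      by_cases hw : w ∈ Metric.ball (0 : E) ((1 / 2) ^ k * R)
      · rw [indicator_of_mem hw, indicator_of_mem hw]
      · rw [indicator_of_notMem hw, indicator_of_notMem hw, zero_mul]
    have hlim : Tendsto (fun k ↦ ∫⁻ w in Metric.ball (0 : E) R, f k w ∂μ) atTop (𝓝 0) := by
      simp_rw [hint]
      apply tendsto_setLIntegral_zero hfin
      have : ∀ k : ℕ, μ (Metric.ball (0 : E) ((1 / 2) ^ k * R))
          = ENNReal.ofReal (((1 / 2) ^ k * R) ^ finrank ℝ E) * μ (Metric.ball 0 1) :=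
        fun k ↦ Measure.addHaar_ball μ _ (by positivity)
      simp_rw [Function.comp_def, this]
      rw [← zero_mul (μ (Metric.ball (0 : E) 1))]
      apply ENNReal.Tendsto.mul_const _ (Or.inr measure_ball_lt_top.ne)
      rw [← ENNReal.ofReal_zero]
      apply ENNReal.tendsto_ofReal
      have h0 : Tendsto (fun k : ℕ ↦ (1 / 2 : ℝ) ^ k * R) atTop (𝓝 (0 * R)) :=
        (tendsto_pow_atTop_nhds_zero_of_lt_one (by norm_num) (by norm_num)).mul_const _
      have := h0.pow (finrank ℝ E)
      rwa [zero_mul, zero_pow (finrank_pos (R := ℝ) (M := E)).ne'] at this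
    -- Fatou's lemma. A vanishing lower limit is enough: for each ε, a single good k suffices in the
    -- iterated inequality.
    have hzero : ∫⁻ w in Metric.ball (0 : E) R, liminf (fun k ↦ f k w) atTop ∂μ = 0 := by
      refine le_antisymm ((lintegral_liminf_le hfm).trans ?_) zero_le
      rw [hlim.liminf_eq]
    rw [lintegral_eq_zero_iff (Measurable.liminf hfm)] at hzero
    have hne : ∀ᵐ w ∂(μ.restrict (Metric.ball (0 : E) R)), w ≠ 0 :=
      ae_restrict_of_ae (by
        rw [ae_iff]; simp)
    filter_upwards [hzero, hne] with w hw hw0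
    have hκ0 : κ w ≠ 0 := by
      simp only [hκ, ne_eq, ENNReal.inv_eq_zero]
      exact ENNReal.rpow_ne_top_of_nonneg (by positivity) enorm_ne_top
    have hκt : κ w ≠ ⊤ := by
      simp only [hκ, ne_eq, ENNReal.inv_eq_top]
      exact (ENNReal.rpow_pos (enorm_pos.2 hw0) enorm_ne_top).ne'
    refine ENNReal.le_of_forall_pos_le_add fun ε hε _ ↦ ?_
    have hlt : liminf (fun k ↦ f k w) atTop < ε * κ w := by
      rw [hw]
      exact ENNReal.mul_pos (by simpa using hε.ne') hκ0
    obtain ⟨k, hk⟩ := (frequently_lt_of_liminf_lt (by isBoundedDefault) hlt).exists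
    have hk' : 2 ^ k * incrementMass μ U B ((1 / 2 : ℝ) ^ k • w) ≤ ε := by
      have : (2 ^ k * incrementMass μ U B ((1 / 2 : ℝ) ^ k • w)) * κ w ≤ ε * κ w := by
        rw [mul_assoc]; exact hk.le
      rwa [ENNReal.mul_le_mul_iff_left hκ0 hκt] at this
    refine (incrementMass_le_pow_mul_add_tsum hU hmid w k).trans ?_
    rw [add_comm]
    exact add_le_add le_rfl hk'
  filter_upwards [ae_all_iff.2 main] with w hw
  obtain ⟨R, hR⟩ := exists_nat_gt ‖w‖
  exact hw R (by simpa using hR)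

/-- The constant in the fractional estimate on convex sets. -/
noncomputable def scalingConst (q : ℝ) : ℝ≥0∞ := ∑' j : ℕ, ((2 : ℝ≥0∞) ^ (1 - q)) ^ (j + 1)

/-- The series is geometric of ratio 2^(1 - q); this is where the hypothesis sp > 1 is decisive. -/
lemma scalingConst_ne_top {q : ℝ} (hq : 1 < q) : scalingConst q ≠ ⊤ := by
  rw [scalingConst, ENNReal.tsum_geometric_add_one]
  have h : (2 : ℝ≥0∞) ^ (1 - q) < 1 := ENNReal.rpow_lt_one_of_one_lt_of_neg (by norm_num) (by linarith)
  refine ENNReal.mul_ne_top h.ne_top ?_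
  simpa [tsub_eq_zero_iff_le] using h

lemma two_pow_mul_ofReal_half_pow (q : ℝ) (j : ℕ) :
    (2 : ℝ≥0∞) ^ j * ENNReal.ofReal ((1 / 2) ^ j) ^ q = ((2 : ℝ≥0∞) ^ (1 - q)) ^ j := by
  have h : ENNReal.ofReal ((1 / 2) ^ j) = (2 : ℝ≥0∞) ^ (-(j : ℝ)) := by
    rw [ENNReal.rpow_neg, ENNReal.rpow_natCast, ENNReal.ofReal_pow (by norm_num), one_div,
      ENNReal.ofReal_inv_of_pos (by norm_num), ENNReal.ofReal_ofNat, ENNReal.inv_pow]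
  rw [h, ← ENNReal.rpow_mul, ← ENNReal.rpow_natCast, ← ENNReal.rpow_natCast, ← ENNReal.rpow_mul,
    ← ENNReal.rpow_add _ _ (by norm_num) (by norm_num)]
  congr 1; ring

/-- **Fractional estimate on a convex set.** If every pair of `B` has a half in `B` or `D`,
and if the weight `‖x - y‖ ^ (-(d + 1))` is integrable on `B`, then the integral of a more singular
weight on `B` is controlled by its integral on `D`. -/
theorem lintegral_indicator_div_edist_le [Nontrivial E] {U : Set E} (hU : Convex ℝ U)
    (hUm : MeasurableSet U) {B D : Set (E × E)} (hB : MeasurableSet B) (hD : MeasurableSet D)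
    (hmid : ∀ x ∈ U, ∀ y ∈ U, (x, y) ∈ B →
      (x, midpoint ℝ x y) ∈ B ∪ D ∨ (midpoint ℝ x y, y) ∈ B ∪ D)
    (hfin : ∫⁻ x in U, ∫⁻ y in U, B.indicator 1 (x, y) / edist x y ^ ((finrank ℝ E : ℝ) + 1)
      ∂μ ∂μ ≠ ⊤) {q : ℝ} (hq : 1 < q) :
    ∫⁻ x in U, ∫⁻ y in U, B.indicator 1 (x, y) / edist x y ^ ((finrank ℝ E : ℝ) + q) ∂μ ∂μ
      ≤ scalingConst q * ∫⁻ x in U, ∫⁻ y in U,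
        D.indicator 1 (x, y) / edist x y ^ ((finrank ℝ E : ℝ) + q) ∂μ ∂μ := by
  have conv : ∀ {S : Set (E × E)}, MeasurableSet S → ∀ α : ℝ,
      ∫⁻ x in U, ∫⁻ y in U, S.indicator 1 (x, y) / edist x y ^ α ∂μ ∂μ
        = ∫⁻ w, incrementMass μ U S w * (‖w‖ₑ ^ α)⁻¹ ∂μ := by
    intro S hS α
    rw [← lintegral_lintegral_indicator_eq_incrementMass hUm hS (by fun_prop)]
    refine lintegral_congr fun x ↦ lintegral_congr fun y ↦ ?_
    rw [edist_comm, edist_eq_enorm_sub, div_eq_mul_inv]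
  rw [conv hB] at hfin
  rw [conv hB, conv hD]
  have hae := ae_incrementMass_le_tsum hU hUm hB hmid hfin
  have hDm : Measurable (incrementMass μ U D) := measurable_incrementMass hUm hD
  set κ : E → ℝ≥0∞ := fun w ↦ (‖w‖ₑ ^ ((finrank ℝ E : ℝ) + q))⁻¹ with hκ
  have hκm : Measurable κ := by fun_prop
  calc ∫⁻ w, incrementMass μ U B w * κ w ∂μ
      ≤ ∫⁻ w, ∑' j : ℕ, 2 ^ (j + 1) *
          (incrementMass μ U D ((1 / 2 : ℝ) ^ (j + 1) • w) * κ w) ∂μ := by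
        refine lintegral_mono_ae ?_
        filter_upwards [hae] with w hw
        simp_rw [← mul_assoc]
        rw [ENNReal.tsum_mul_right]
        gcongr
    _ = ∑' j : ℕ, 2 ^ (j + 1) *
          ∫⁻ w, incrementMass μ U D ((1 / 2 : ℝ) ^ (j + 1) • w) * κ w ∂μ := by
        rw [lintegral_tsum]
        · refine tsum_congr fun j ↦ lintegral_const_mul' _ _ (by simp)
        · intro j
          exact (((hDm.comp (measurable_const_smul _)).mul hκm).const_mul _).aemeasurable
    _ = _ := by
        rw [scalingConst, ← ENNReal.tsum_mul_right]
        refine tsum_congr fun j ↦ ?_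
        -- Scale j carries a factor 2^(j + 1) from the iteration and 2^(-(j + 1) q) from the
        -- dilation.
        rw [lintegral_comp_smul_mul_inv_rpow (incrementMass μ U D) (by positivity)
          (by linarith : 0 < q), ← mul_assoc, two_pow_mul_ofReal_half_pow]

end ConvexEstimate

/-! ### Bi-Lipschitz charts with convex domain -/

section Charts

open Filter Topology

variable {E : Type*} [NormedAddCommGroup E] [NormedSpace ℝ E] {H : Type*} [TopologicalSpace H]
  (I : ModelWithCorners ℝ E H) {M : Type*}

section
variable [TopologicalSpace M] [ChartedSpace H M] [IsManifold I 1 M]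
  [RiemannianBundle (fun x : M ↦ TangentSpace I x)]
  [IsContinuousRiemannianBundle E (fun x : M ↦ TangentSpace I x)]

/-- The operator norm bound is evaluated on single vectors, the form needed under the integral of a
path length. -/
lemma eventually_enorm_mfderiv_extChartAt_apply_le (x : M) :
    ∃ C : ℝ≥0, 0 < C ∧ ∀ᶠ y in 𝓝 x, ∀ v : TangentSpace I y,
      ‖(show E from mfderiv I 𝓘(ℝ, E) (extChartAt I x) y v)‖ₑ ≤ C * ‖v‖ₑ := by
  obtain ⟨C, hC, h⟩ := eventually_enorm_mfderiv_extChartAt_lt I x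
  refine ⟨C, hC, ?_⟩
  filter_upwards [h] with y hy v
  let : NormedAddCommGroup (TangentSpace 𝓘(ℝ, E) (extChartAt I x y)) :=
    normedAddCommGroupTangentSpaceVectorSpace _
  let : NormedSpace ℝ (TangentSpace 𝓘(ℝ, E) (extChartAt I x y)) :=
    normedSpaceTangentSpaceVectorSpace _
  refine (ContinuousLinearMap.le_opENorm (mfderiv I 𝓘(ℝ, E) (extChartAt I x) y) v).trans ?_
  gcongr
  exact hy.le

lemma eventually_enorm_mfderivWithin_symm_extChartAt_apply_le (x : M) :
    ∃ C : ℝ≥0, 0 < C ∧ ∀ᶠ y in 𝓝[range I] (extChartAt I x x), ∀ v : E,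
      ‖mfderivWithin 𝓘(ℝ, E) I (extChartAt I x).symm (range I) y v‖ₑ ≤ C * ‖v‖ₑ := by
  obtain ⟨C, hC, h⟩ := eventually_enorm_mfderivWithin_symm_extChartAt_lt I x
  refine ⟨C, hC, ?_⟩
  filter_upwards [h] with y hy v
  let : NormedAddCommGroup (TangentSpace 𝓘(ℝ, E) y) :=
    normedAddCommGroupTangentSpaceVectorSpace _
  let : NormedSpace ℝ (TangentSpace 𝓘(ℝ, E) y) :=
    normedSpaceTangentSpaceVectorSpace _
  refine (ContinuousLinearMap.le_opENorm
    (mfderivWithin 𝓘(ℝ, E) I (extChartAt I x).symm (range I) y) v).trans ?_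
  gcongr
  exacts [hy.le, le_rfl]
end

section
variable [EMetricSpace M] [ChartedSpace H M] [IsManifold I 1 M]
  [RiemannianBundle (fun x : M ↦ TangentSpace I x)]
  [IsContinuousRiemannianBundle E (fun x : M ↦ TangentSpace I x)] [IsRiemannianManifold I M]

omit [IsManifold I 1 M] [IsContinuousRiemannianBundle E (fun x : M ↦ TangentSpace I x)] in
lemma edist_le_pathELength {γ : ℝ → M} {a b : ℝ} (hab : a ≤ b)
    (hγ : ContMDiffOn 𝓘(ℝ, ℝ) I 1 γ (Icc a b)) : edist (γ a) (γ b) ≤ pathELength I γ a b := by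
  rw [IsRiemannianManifold.out (I := I)]
  exact riemannianEDist_le_pathELength hγ rfl rfl hab

/-- The inverse of an extended chart is Lipschitz near the base point. -/
lemma exists_edist_extChartAt_symm_le (x : M) :
    ∃ C : ℝ≥0, ∃ r > 0, Metric.ball (extChartAt I x x) r ∩ range I ⊆ (extChartAt I x).target ∧
      ∀ v ∈ Metric.ball (extChartAt I x x) r ∩ range I,
      ∀ w ∈ Metric.ball (extChartAt I x x) r ∩ range I,
        edist ((extChartAt I x).symm v) ((extChartAt I x).symm w) ≤ C * edist v w := by
  obtain ⟨C, C_pos, hC⟩ := eventually_enorm_mfderivWithin_symm_extChartAt_apply_le I x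
  obtain ⟨r, r_pos, hr⟩ := Metric.mem_nhdsWithin_iff.1
    (inter_mem (extChartAt_target_mem_nhdsWithin x) hC)
  refine ⟨C, r, r_pos, fun z hz ↦ (hr hz).1, fun v hv w hw ↦ ?_⟩
  -- The segment stays in the domain because `range I` is convex, even at a boundary or corner; its
  -- image is a competitor for the geodesic distance.
  let η := ContinuousAffineMap.lineMap (R := ℝ) v w
  have hη : Icc 0 1 ⊆ ⇑η ⁻¹' (Metric.ball (extChartAt I x x) r ∩ range I) := by
    simp only [← image_subset_iff, ContinuousAffineMap.coe_lineMap_eq,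
      ← segment_eq_image_lineMap, η]
    exact ((convex_ball _ _).inter I.convex_range).segment_subset hv hw
  have hη1 : Icc 0 1 ⊆ ⇑η ⁻¹' (extChartAt I x).target := fun t ht ↦ (hr (hη ht)).1
  have η_smooth : ContMDiffOn 𝓘(ℝ, ℝ) 𝓘(ℝ, E) 1 η (Icc 0 1) := by
    apply ContMDiff.contMDiffOn
    rw [contMDiff_iff_contDiff]
    exact ContinuousAffineMap.contDiff _
  have h1 := edist_le_pathELength I zero_le_one
    ((contMDiffOn_extChartAt_symm (I := I) (n := 1) x).comp η_smooth hη1)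
  simp only [Function.comp_apply] at h1
  rw [show η 0 = v by simp [η, ContinuousAffineMap.coe_lineMap_eq],
    show η 1 = w by simp [η, ContinuousAffineMap.coe_lineMap_eq]] at h1
  refine h1.trans ?_
  rw [← lintegral_fderiv_lineMap_eq_edist, pathELength_eq_lintegral_mfderivWithin_Icc,
    ← lintegral_const_mul' _ _ ENNReal.coe_ne_top]
  apply setLIntegral_mono' measurableSet_Icc (fun t ht ↦ ?_)
  have h2 : mfderivWithin 𝓘(ℝ, ℝ) I ((extChartAt I x).symm ∘ η) (Icc 0 1) t =
      (mfderivWithin 𝓘(ℝ, E) I (extChartAt I x).symm (range I) (η t)) ∘L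
        (mfderivWithin 𝓘(ℝ, ℝ) 𝓘(ℝ, E) η (Icc 0 1) t) := by
    apply mfderivWithin_comp
    · exact mdifferentiableWithinAt_extChartAt_symm (hη1 ht)
    · exact η_smooth.mdifferentiableOn one_ne_zero t ht
    · exact hη1.trans (preimage_mono (extChartAt_target_subset_range x))
    · rw [uniqueMDiffWithinAt_iff_uniqueDiffWithinAt]
      exact uniqueDiffOn_Icc zero_lt_one t ht
  have h3 : mfderivWithin 𝓘(ℝ, ℝ) I ((extChartAt I x).symm ∘ η) (Icc 0 1) t 1 =
      (mfderivWithin 𝓘(ℝ, E) I (extChartAt I x).symm (range I) (η t))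
        (mfderivWithin 𝓘(ℝ, ℝ) 𝓘(ℝ, E) η (Icc 0 1) t 1) := congr($h2 1)
  rw [h3, mfderivWithin_eq_fderivWithin]
  exact (hr (hη ht)).2 _

/-- An extended chart is Lipschitz near the base point. -/
lemma exists_edist_extChartAt_le (x : M) :
    ∃ C : ℝ≥0, ∃ W ∈ 𝓝 x, ∀ y ∈ W, ∀ z ∈ W,
      edist (extChartAt I x y) (extChartAt I x z) ≤ C * edist y z := by
  obtain ⟨C, C_pos, hC⟩ := eventually_enorm_mfderiv_extChartAt_apply_le I x
  obtain ⟨ε, ε_pos, hε⟩ := EMetric.mem_nhds_iff.1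
    (inter_mem (chart_source_mem_nhds H x) hC)
  -- A third of the radius: a path of length less than 2ε/3 that starts within ε/3 of x remains in
  -- the ball where the derivative bound holds.
  refine ⟨C, Metric.eball x (ε / 3), Metric.eball_mem_nhds _ (ENNReal.div_pos ε_pos.ne' (by simp)),
    fun y hy z hz ↦ ?_⟩
  have key : ∀ L, edist y z < L → L ≤ ε / 3 + ε / 3 →
      edist (extChartAt I x y) (extChartAt I x z) ≤ C * L := by
    intro L hL hLε
    rw [IsRiemannianManifold.out (I := I)] at hL
    obtain ⟨γ, hγ0, hγ1, hγ, hγL, -⟩ :=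
      exists_lt_locally_constant_of_riemannianEDist_lt hL zero_lt_one
    have hmem : ∀ t ∈ Icc (0 : ℝ) 1, γ t ∈ Metric.eball x ε := by
      intro t ht
      have h1 : edist (γ 0) (γ t) < L :=
        ((edist_le_pathELength I ht.1 hγ.contMDiffOn).trans
          (pathELength_mono le_rfl ht.2)).trans_lt hγL
      rw [hγ0] at h1
      rw [Metric.mem_eball] at hy ⊢
      calc edist (γ t) x ≤ edist (γ t) y + edist y x := edist_triangle _ _ _
        _ = edist y x + edist y (γ t) := by rw [add_comm, edist_comm (γ t)]
        _ < ε / 3 + (ε / 3 + ε / 3) := ENNReal.add_lt_add hy (h1.trans_le hLε)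
        _ = ε := by rw [← add_assoc, ENNReal.add_thirds]
    have hsmooth : ContMDiffOn 𝓘(ℝ, ℝ) 𝓘(ℝ, E) 1 (extChartAt I x ∘ γ) (Icc 0 1) :=
      contMDiffOn_extChartAt.comp (t := (chartAt H x).source) hγ.contMDiffOn
        (fun t ht ↦ (hε (hmem t ht)).1)
    have hdist := enorm_sub_le_lintegral_derivWithin_Icc_of_contDiffOn_Icc
      (contMDiffOn_iff_contDiffOn.1 hsmooth) zero_le_one
    simp only [Function.comp_apply, hγ0, hγ1] at hdist
    rw [edist_comm, edist_eq_enorm_sub]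
    refine hdist.trans (le_trans ?_ (mul_le_mul_right hγL.le _))
    rw [pathELength_eq_lintegral_mfderivWithin_Icc, ← lintegral_const_mul' _ _ ENNReal.coe_ne_top]
    apply setLIntegral_mono' measurableSet_Icc (fun t ht ↦ ?_)
    have h2 : mfderivWithin 𝓘(ℝ, ℝ) 𝓘(ℝ, E) (extChartAt I x ∘ γ) (Icc 0 1) t =
        (mfderiv I 𝓘(ℝ, E) (extChartAt I x) (γ t)) ∘L
          (mfderivWithin 𝓘(ℝ, ℝ) I γ (Icc 0 1) t) := by
      apply mfderiv_comp_mfderivWithin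
      · exact mdifferentiableAt_extChartAt (hε (hmem t ht)).1
      · exact (hγ.mdifferentiable one_ne_zero).mdifferentiableOn _ ht
      · rw [uniqueMDiffWithinAt_iff_uniqueDiffWithinAt]
        exact uniqueDiffOn_Icc zero_lt_one _ ht
    have h3 : derivWithin (extChartAt I x ∘ γ) (Icc 0 1) t =
        (mfderiv I 𝓘(ℝ, E) (extChartAt I x) (γ t)) (mfderivWithin 𝓘(ℝ, ℝ) I γ (Icc 0 1) t 1) := by
      rw [← fderivWithin_derivWithin, ← mfderivWithin_eq_fderivWithin]
      exact congr($h2 1)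
    rw [h3]
    exact (hε (hmem t ht)).2 _
  -- Path lengths only approach the distance from above, so a failure of the bound is contradicted
  -- with an intermediate length L.
  by_contra! hlt
  have hyz : edist y z < ε / 3 + ε / 3 :=
    (edist_triangle_right _ _ x).trans_lt (ENNReal.add_lt_add hy hz)
  have hdiv : edist y z < edist (extChartAt I x y) (extChartAt I x z) / C := by
    rwa [ENNReal.lt_div_iff_mul_lt (Or.inl (by simpa using C_pos.ne')) (Or.inl ENNReal.coe_ne_top),
      mul_comm]
  obtain ⟨L, hL1, hL2⟩ := exists_between (lt_min hyz hdiv)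
  have h1 := key L hL1 (hL2.le.trans (min_le_left _ _))
  have h2 : L * C < edist (extChartAt I x y) (extChartAt I x z) := by
    rw [← ENNReal.lt_div_iff_mul_lt (Or.inl (by simpa using C_pos.ne'))
      (Or.inl ENNReal.coe_ne_top)]
    exact hL2.trans_le (min_le_right _ _)
  rw [mul_comm] at h2
  exact absurd h1 (not_le.2 h2)

end

/-- `A` is the image under the map `g` of the convex set `U`, which has nonempty interior, and
`g` is bi-Lipschitz on `U`. -/
structure IsConvexPatch [MeasurableSpace E] [EMetricSpace M] [MeasurableSpace M] (A : Set M)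
    (U : Set E) (g : E → M) (K : ℝ≥0) : Prop where
  measurableSet : MeasurableSet A
  convex : Convex ℝ U
  pos : 0 < K
  measurableSet_dom : MeasurableSet U
  nonempty_interior : (interior U).Nonempty
  isBounded : Bornology.IsBounded U
  measurable : Measurable g
  image_eq : g '' U = A
  lipschitzOnWith : LipschitzOnWith K g U
  edist_le : ∀ v ∈ U, ∀ w ∈ U, edist v w ≤ K * edist (g v) (g w)

/-- Every point of a Riemannian manifold has arbitrarily small neighborhoods that are bi-Lipschitz
to a convex set. -/
theorem exists_isConvexPatch [MeasurableSpace E] [BorelSpace E] [EMetricSpace M] [MeasurableSpace M]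
    [BorelSpace M] [ChartedSpace H M] [IsManifold I 1 M]
    [RiemannianBundle (fun x : M ↦ TangentSpace I x)]
    [IsContinuousRiemannianBundle E (fun x : M ↦ TangentSpace I x)] [IsRiemannianManifold I M]
    (x : M) {O : Set M} (hO : O ∈ 𝓝 x) :
    ∃ A ∈ 𝓝 x, A ⊆ O ∧ ∃ (U : Set E) (g : E → M) (K : ℝ≥0), IsConvexPatch A U g K := by
  classical
  obtain ⟨C₁, r₁, r₁_pos, htarget, h₁⟩ := exists_edist_extChartAt_symm_le I x
  obtain ⟨C₂, W, hW, h₂⟩ := exists_edist_extChartAt_le I x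
  obtain ⟨r₂, r₂_pos, hr₂⟩ := Metric.mem_nhds_iff.1
    (extChartAt_preimage_mem_nhds (I := I) (inter_mem hW hO))
  set r := min r₁ r₂ with hr
  have r_pos : 0 < r := lt_min r₁_pos r₂_pos
  set U := Metric.ball (extChartAt I x x) r ∩ range I with hU
  have hU1 : U ⊆ Metric.ball (extChartAt I x x) r₁ ∩ range I :=
    inter_subset_inter_left _ (Metric.ball_subset_ball (min_le_left _ _))
  have hU2 : ∀ v ∈ U, (extChartAt I x).symm v ∈ W ∩ O := fun v hv ↦
    hr₂ (Metric.ball_subset_ball (min_le_right _ _) hv.1)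
  have hUt : U ⊆ (extChartAt I x).target := hU1.trans htarget
  have hUm : MeasurableSet U :=
    Metric.isOpen_ball.measurableSet.inter I.isClosed_range.measurableSet
  -- The constant value off `U` is arbitrary; it makes the map measurable everywhere.
  set g := U.piecewise (extChartAt I x).symm (fun _ ↦ x) with hg
  have hgU : EqOn g (extChartAt I x).symm U := piecewise_eqOn _ _ _
  have himage : g '' U = (extChartAt I x).source ∩
      extChartAt I x ⁻¹' Metric.ball (extChartAt I x x) r := by
    rw [hgU.image_eq]
    ext y
    constructor
    · rintro ⟨v, hv, rfl⟩
      refine ⟨(extChartAt I x).map_target (hUt hv), ?_⟩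
      rw [mem_preimage, (extChartAt I x).right_inv (hUt hv)]
      exact hv.1
    · rintro ⟨hy, hy'⟩
      exact ⟨extChartAt I x y, ⟨hy', extChartAt_target_subset_range x
        ((extChartAt I x).map_source hy)⟩, (extChartAt I x).left_inv hy⟩
  have hopen : IsOpen (g '' U) := by
    rw [himage]
    exact isOpen_extChartAt_preimage' x Metric.isOpen_ball
  refine ⟨g '' U, hopen.mem_nhds ?_, ?_, U, g, max 1 (max C₁ C₂), ?_⟩
  · rw [himage]
    exact ⟨mem_extChartAt_source x, by simpa using r_pos⟩
  · rintro _ ⟨v, hv, rfl⟩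
    rw [hgU hv]
    exact (hU2 v hv).2
  · refine ⟨hopen.measurableSet, (convex_ball _ _).inter I.convex_range,
      by positivity, hUm, ?_,
      Metric.isBounded_ball.subset inter_subset_left, ?_, rfl, ?_, ?_⟩
    -- Even if x is a boundary point, the model range lies in the closure of its interior, so the
    -- ball meets that interior.
    · have h := I.range_subset_closure_interior (mem_range_self (chartAt H x x))
      obtain ⟨z, hz, hz'⟩ := mem_closure_iff.1 h (Metric.ball (extChartAt I x x) r)
        Metric.isOpen_ball (by simpa [extChartAt_coe] using r_pos)
      refine ⟨z, ?_⟩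
      rw [hU, interior_inter, Metric.isOpen_ball.interior_eq]
      exact ⟨hz, hz'⟩
    · exact ContinuousOn.measurable_piecewise ((continuousOn_extChartAt_symm x).mono hUt)
        continuousOn_const hUm
    · intro v hv w hw
      rw [hgU hv, hgU hw]
      refine (h₁ v (hU1 hv) w (hU1 hw)).trans ?_
      gcongr
      exact (le_max_left _ _).trans (le_max_right _ _)
    · intro v hv w hw
      rw [hgU hv, hgU hw]
      have := h₂ _ (hU2 v hv).1 _ (hU2 w hw).1
      rw [(extChartAt I x).right_inv (hUt hv), (extChartAt I x).right_inv (hUt hw)] at this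
      refine this.trans ?_
      gcongr
      exact (le_max_right _ _).trans (le_max_right _ _)

end Charts

/-! ### The estimate on a patch of the manifold -/

section LocalEstimate

open Module Filter Topology

lemma LipschitzOnWith.euclideanHausdorffMeasure_image_le {X Y : Type*} [EMetricSpace X]
    [MeasurableSpace X] [BorelSpace X] [EMetricSpace Y] [MeasurableSpace Y] [BorelSpace Y]
    {K : ℝ≥0} {f : X → Y} {s : Set X} (h : LipschitzOnWith K f s) (m : ℕ) :
    μHE[m] (f '' s) ≤ (K : ℝ≥0∞) ^ m * μHE[m] s := by
  simp only [Measure.euclideanHausdorffMeasure_def, Measure.smul_apply]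
  have := h.hausdorffMeasure_image_le (d := m) (by positivity)
  rw [ENNReal.rpow_natCast] at this
  rw [ENNReal.smul_def, ENNReal.smul_def, smul_eq_mul, smul_eq_mul, mul_left_comm]
  gcongr

/-- Compares the singular kernels of a patch and of its convex model, in either direction. -/
lemma ENNReal.div_rpow_le_mul_div_rpow {a b b' : ℝ≥0∞} {K : ℝ≥0} (hK : 0 < K) (h : b' ≤ K * b)
    {α : ℝ} (hα : 0 ≤ α) : a / b ^ α ≤ K ^ α * (a / b' ^ α) := by
  have hK0 : (K : ℝ≥0∞) ≠ 0 := by simpa using hK.ne'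
  have h1 : (K : ℝ≥0∞) ^ α ≠ 0 := (ENNReal.rpow_pos (by simpa using hK) ENNReal.coe_ne_top).ne'
  have h2 : (K : ℝ≥0∞) ^ α ≠ ⊤ := ENNReal.rpow_ne_top_of_nonneg hα ENNReal.coe_ne_top
  have h3 : b' ^ α ≤ K ^ α * b ^ α := by
    rw [← ENNReal.mul_rpow_of_nonneg _ _ hα]
    exact ENNReal.rpow_le_rpow h hα
  calc a / b ^ α = (K : ℝ≥0∞) ^ α * (a * ((K : ℝ≥0∞) ^ α * b ^ α)⁻¹) := by
        rw [ENNReal.mul_inv (Or.inl h1) (Or.inl h2), div_eq_mul_inv, mul_left_comm a,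
          ← mul_assoc, ENNReal.mul_inv_cancel h1 h2, one_mul]
    _ ≤ K ^ α * (a / b' ^ α) := by
        rw [div_eq_mul_inv]
        gcongr

variable {m : ℕ} {M : Type*} [EMetricSpace M] [MeasurableSpace M] [BorelSpace M] {A : Set M}
  {U : Set (EuclideanSpace ℝ (Fin m))} {g : EuclideanSpace ℝ (Fin m) → M} {K : ℝ≥0}

namespace IsConvexPatch

lemma restrict_le_map (h : IsConvexPatch A U g K) :
    (μHE[m] : Measure M).restrict A ≤ (K : ℝ≥0∞) ^ m • (volume.restrict U).map g := by
  refine Measure.le_iff.2 fun S hS ↦ ?_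
  rw [Measure.restrict_apply hS, Measure.smul_apply, Measure.map_apply h.measurable hS,
    Measure.restrict_apply (h.measurable hS), smul_eq_mul,
    ← EuclideanSpace.euclideanHausdorffMeasure_eq_volume]
  refine le_trans (measure_mono ?_)
    ((h.lipschitzOnWith.mono inter_subset_right).euclideanHausdorffMeasure_image_le m)
  rintro y ⟨hy, hyA⟩
  rw [← h.image_eq] at hyA
  obtain ⟨v, hv, rfl⟩ := hyA
  exact ⟨v, ⟨hy, hv⟩, rfl⟩

/-- The lower distance bound makes the parametrization injective with a `K`-Lipschitz inverse, to
which the Hausdorff measure bound applies. -/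
lemma map_le_restrict (h : IsConvexPatch A U g K) :
    (volume.restrict U).map g ≤ (K : ℝ≥0∞) ^ m • (μHE[m] : Measure M).restrict A := by
  have hinj : InjOn g U := by
    intro v hv w hw hvw
    have := h.edist_le v hv w hw
    rwa [hvw, edist_self, mul_zero, nonpos_iff_eq_zero, edist_eq_zero] at this
  have hlip : LipschitzOnWith K (Function.invFunOn g U) A := by
    intro x hx y hy
    rw [← h.image_eq] at hx hy
    obtain ⟨v, hv, rfl⟩ := hx
    obtain ⟨w, hw, rfl⟩ := hy
    rw [hinj.leftInvOn_invFunOn hv, hinj.leftInvOn_invFunOn hw]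
    exact h.edist_le v hv w hw
  refine Measure.le_iff.2 fun S hS ↦ ?_
  rw [Measure.smul_apply, Measure.restrict_apply hS, Measure.map_apply h.measurable hS,
    Measure.restrict_apply (h.measurable hS), smul_eq_mul,
    ← EuclideanSpace.euclideanHausdorffMeasure_eq_volume]
  refine le_trans (measure_mono ?_)
    ((hlip.mono inter_subset_right).euclideanHausdorffMeasure_image_le m)
  rintro v ⟨hv, hvU⟩
  exact ⟨g v, ⟨hv, h.image_eq ▸ mem_image_of_mem g hvU⟩, hinj.leftInvOn_invFunOn hvU⟩

lemma measure_lt_top (h : IsConvexPatch A U g K) : (μHE[m] : Measure M) A < ⊤ := by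
  have := h.restrict_le_map univ
  rw [Measure.restrict_apply_univ, Measure.smul_apply, Measure.map_apply h.measurable .univ,
    preimage_univ, Measure.restrict_apply_univ, smul_eq_mul] at this
  exact this.trans_lt (ENNReal.mul_lt_top (by simp) h.isBounded.measure_lt_top)

lemma measure_pos (h : IsConvexPatch A U g K) : 0 < (μHE[m] : Measure M) A := by
  have h1 := h.map_le_restrict univ
  rw [Measure.smul_apply, Measure.restrict_apply_univ, Measure.map_apply h.measurable .univ,
    preimage_univ, Measure.restrict_apply_univ, smul_eq_mul] at h1
  have h2 : 0 < (volume U : ℝ≥0∞) :=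
    (isOpen_interior.measure_pos volume h.nonempty_interior).trans_le (measure_mono interior_subset)
  rw [pos_iff_ne_zero]
  intro h0
  rw [h0, mul_zero] at h1
  exact (h2.trans_le h1).ne rfl

/-- In this direction no measurability of `f` is needed, since `lintegral_map_le` holds for all
functions. -/
lemma setLIntegral_le (h : IsConvexPatch A U g K) (f : M → ℝ≥0∞) :
    ∫⁻ x in A, f x ∂μHE[m] ≤ (K : ℝ≥0∞) ^ m * ∫⁻ v in U, f (g v) := by
  refine (lintegral_mono' h.restrict_le_map le_rfl).trans ?_
  rw [lintegral_smul_measure, smul_eq_mul]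
  gcongr
  exact lintegral_map_le f g

lemma setLIntegral_comp_le (h : IsConvexPatch A U g K) {f : M → ℝ≥0∞} (hf : Measurable f) :
    ∫⁻ v in U, f (g v) ≤ (K : ℝ≥0∞) ^ m * ∫⁻ x in A, f x ∂μHE[m] := by
  rw [← lintegral_map hf h.measurable]
  refine (lintegral_mono' h.map_le_restrict le_rfl).trans ?_
  rw [lintegral_smul_measure, smul_eq_mul]

lemma lintegral_lintegral_le (h : IsConvexPatch A U g K) (f : M → M → ℝ≥0∞) :
    ∫⁻ x in A, ∫⁻ y in A, f x y ∂μHE[m] ∂μHE[m]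
      ≤ (K : ℝ≥0∞) ^ m * (K : ℝ≥0∞) ^ m * ∫⁻ v in U, ∫⁻ w in U, f (g v) (g w) := by
  refine (h.setLIntegral_le _).trans ?_
  rw [mul_assoc]
  refine mul_le_mul_right ?_ _
  rw [← lintegral_const_mul' _ _ (by simp)]
  exact lintegral_mono fun v ↦ h.setLIntegral_le _

lemma lintegral_lintegral_comp_le (h : IsConvexPatch A U g K) {f : M → M → ℝ≥0∞}
    (hf : Measurable (Function.uncurry f)) :
    ∫⁻ v in U, ∫⁻ w in U, f (g v) (g w)
      ≤ (K : ℝ≥0∞) ^ m * (K : ℝ≥0∞) ^ m * ∫⁻ x in A, ∫⁻ y in A, f x y ∂μHE[m] ∂μHE[m] := by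
  have : IsFiniteMeasure ((μHE[m] : Measure M).restrict A) :=
    isFiniteMeasure_restrict.2 h.measure_lt_top.ne
  rw [mul_assoc]
  refine le_trans ?_ (mul_le_mul_right (h.setLIntegral_comp_le hf.lintegral_prod_right) _)
  rw [← lintegral_const_mul' _ _ (by simp)]
  exact lintegral_mono fun v ↦ h.setLIntegral_comp_le hf.of_uncurry_left

/-- The fractional estimate on a convex patch, for maps `u` and `v` whose increments coincide
when those of `u` are smaller than `r`. -/
theorem exists_lintegral_le [SecondCountableTopology M] (h : IsConvexPatch A U g K)
    {Y Y' : Type*} [EMetricSpace Y]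
    [EMetricSpace Y'] [MeasurableSpace Y] [BorelSpace Y] [SecondCountableTopology Y]
    [MeasurableSpace Y'] [BorelSpace Y'] [SecondCountableTopology Y'] {s p : ℝ} (hp : 0 < p)
    (hsp : 1 < s * p) (r : ℝ≥0∞) :
    ∃ C : ℝ≥0, ∀ (u : M → Y') (v : M → Y), Measurable u → Measurable v →
      (∀ x y, edist (u x) (u y) < r → edist (v x) (v y) = edist (u x) (u y)) →
      ∫⁻ x, ∫⁻ y in {y | r ≤ edist (u x) (u y)},
        1 / edist x y ^ ((m : ℝ) + 1) ∂μHE[m] ∂μHE[m] < ⊤ →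
      ∫⁻ x in A, ∫⁻ y in A, min (edist (u y) (u x) ^ p) 1 / edist y x ^ ((m : ℝ) + s * p)
        ∂μHE[m] ∂μHE[m] ≤ C * gagliardoEnergy m s p v := by
  rcases Nat.eq_zero_or_pos m with rfl | hm
  -- In dimension zero a patch is a single point and the integrand vanishes there.
  · have hA : A.Subsingleton := by
      rw [← h.image_eq]
      exact U.subsingleton_of_subsingleton.image g
    refine ⟨0, fun u v _ _ _ _ ↦ ?_⟩
    rw [setLIntegral_congr_fun (g := 0) h.measurableSet]
    · simp
    · intro x hx
      simp only [Pi.zero_apply]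
      rw [setLIntegral_congr_fun (g := 0) h.measurableSet]
      · simp
      · intro y hy
        simp [hA hx hy, hp]
  have : Nonempty (Fin m) := ⟨⟨0, hm⟩⟩
  have : Nontrivial (EuclideanSpace ℝ (Fin m)) := inferInstance
  set α : ℝ := (m : ℝ) + s * p with hα
  have hα0 : 0 ≤ α := by positivity
  -- An increment of at least r/2 satisfies 1 ≤ (2/r)^p d^p. For r = 0 the set `D` below is empty,
  -- so 0 will do.
  set c : ℝ≥0∞ := if r = 0 then 0 else (2 / r) ^ p with hc
  have hct : c ≠ ⊤ := by
    rw [hc]; split_ifs with hr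
    · simp
    · exact ENNReal.rpow_ne_top_of_nonneg hp.le (ENNReal.div_ne_top (by simp) hr)
  have hfr : (finrank ℝ (EuclideanSpace ℝ (Fin m)) : ℝ) = m := by simp
  set Km : ℝ≥0∞ := (K : ℝ≥0∞) ^ m * (K : ℝ≥0∞) ^ m with hKm
  have hKmt : Km ≠ ⊤ := by simp [hKm, ENNReal.mul_eq_top]
  have hKα : (K : ℝ≥0∞) ^ α ≠ ⊤ := ENNReal.rpow_ne_top_of_nonneg hα0 ENNReal.coe_ne_top
  -- One `Km` and one `K ^ α` for each passage between the patch and its model; the final 1 accounts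
  -- for the pairs outside `B`.
  set C : ℝ≥0∞ := Km * (K ^ α * (scalingConst (s * p) * (c * (K ^ α * Km)))) + 1 with hC
  have hCt : C ≠ ⊤ := by
    have := scalingConst_ne_top hsp
    refine ENNReal.add_ne_top.2 ⟨?_, by simp⟩
    exact ENNReal.mul_ne_top hKmt (ENNReal.mul_ne_top hKα (ENNReal.mul_ne_top this
      (ENNReal.mul_ne_top hct (ENNReal.mul_ne_top hKα hKmt))))
  refine ⟨C.toNNReal, fun u v hu hv huv hX ↦ ?_⟩
  rw [ENNReal.coe_toNNReal hCt]
  have hud : Measurable fun z : M × M ↦ edist (u z.1) (u z.2) :=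
    (hu.comp measurable_fst).edist (hu.comp measurable_snd)
  have hvd : Measurable fun z : M × M ↦ edist (v z.1) (v z.2) :=
    (hv.comp measurable_fst).edist (hv.comp measurable_snd)
  have hMd : Measurable fun z : M × M ↦ edist z.1 z.2 := measurable_edist
  set B : Set (M × M) := {z | r ≤ edist (u z.1) (u z.2)} with hB
  set D : Set (M × M) := {z | r / 2 ≤ edist (u z.1) (u z.2) ∧ edist (u z.1) (u z.2) < r} with hD
  have hBm : MeasurableSet B := measurableSet_le measurable_const hud
  have hDm : MeasurableSet D :=
    (measurableSet_le measurable_const hud).inter (measurableSet_lt hud measurable_const)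
  set G : EuclideanSpace ℝ (Fin m) × EuclideanSpace ℝ (Fin m) → M × M := Prod.map g g with hG
  have hGm : Measurable G := h.measurable.prodMap h.measurable
  have hlip : ∀ x ∈ U, ∀ y ∈ U, edist (g x) (g y) ≤ K * edist x y := fun x hx y hy ↦
    h.lipschitzOnWith hx hy
  have mono2 : ∀ {f₁ f₂ : EuclideanSpace ℝ (Fin m) → EuclideanSpace ℝ (Fin m) → ℝ≥0∞}
      {a : ℝ≥0∞}, a ≠ ⊤ → (∀ x ∈ U, ∀ y ∈ U, f₁ x y ≤ a * f₂ x y) →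
      ∫⁻ x in U, ∫⁻ y in U, f₁ x y ≤ a * ∫⁻ x in U, ∫⁻ y in U, f₂ x y := by
    intro f₁ f₂ a ha hf
    rw [← lintegral_const_mul' _ _ ha]
    refine setLIntegral_mono' h.measurableSet_dom fun x hx ↦ ?_
    rw [← lintegral_const_mul' _ _ ha]
    exact setLIntegral_mono' h.measurableSet_dom fun y hy ↦ hf x hx y hy
  have hmid : ∀ x ∈ U, ∀ y ∈ U, (x, y) ∈ G ⁻¹' B →
      (x, midpoint ℝ x y) ∈ G ⁻¹' B ∪ G ⁻¹' D ∨ (midpoint ℝ x y, y) ∈ G ⁻¹' B ∪ G ⁻¹' D := by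
    intro x _ y _ hxy
    set z := midpoint ℝ x y
    change r ≤ edist (u (g x)) (u (g y)) at hxy
    change (r ≤ edist (u (g x)) (u (g z)) ∨ (r / 2 ≤ edist (u (g x)) (u (g z)) ∧
        edist (u (g x)) (u (g z)) < r)) ∨ (r ≤ edist (u (g z)) (u (g y)) ∨
        (r / 2 ≤ edist (u (g z)) (u (g y)) ∧ edist (u (g z)) (u (g y)) < r))
    -- If both halves had increments below r/2, the whole increment would be below r.
    have htri := hxy.trans (edist_triangle _ (u (g z)) _)
    by_cases h1 : r / 2 ≤ edist (u (g x)) (u (g z))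
    · rcases le_or_gt r (edist (u (g x)) (u (g z))) with h2 | h2
      exacts [Or.inl (Or.inl h2), Or.inl (Or.inr ⟨h1, h2⟩)]
    by_cases h1' : r / 2 ≤ edist (u (g z)) (u (g y))
    · rcases le_or_gt r (edist (u (g z)) (u (g y))) with h2 | h2
      exacts [Or.inr (Or.inl h2), Or.inr (Or.inr ⟨h1', h2⟩)]
    have := ENNReal.add_lt_add (not_le.1 h1) (not_le.1 h1')
    rw [ENNReal.add_halves] at this
    exact absurd htri (not_le.2 this)
  have hfin : ∫⁻ x in U, ∫⁻ y in U, (G ⁻¹' B).indicator 1 (x, y) /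
      edist x y ^ ((finrank ℝ (EuclideanSpace ℝ (Fin m)) : ℝ) + 1) ≠ ⊤ := by
    rw [hfr]
    have h1 : ∫⁻ x in U, ∫⁻ y in U, (G ⁻¹' B).indicator 1 (x, y) / edist x y ^ ((m : ℝ) + 1)
        ≤ (K : ℝ≥0∞) ^ ((m : ℝ) + 1) * ∫⁻ x in U, ∫⁻ y in U,
          B.indicator 1 (g x, g y) / edist (g x) (g y) ^ ((m : ℝ) + 1) :=
      mono2 (ENNReal.rpow_ne_top_of_nonneg (by positivity) ENNReal.coe_ne_top)
        fun x hx y hy ↦ ENNReal.div_rpow_le_mul_div_rpow h.pos (hlip x hx y hy) (by positivity)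
    have h2 := h.lintegral_lintegral_comp_le
      (f := fun x y ↦ B.indicator 1 (x, y) / edist x y ^ ((m : ℝ) + 1))
      ((measurable_one.indicator hBm).div (hMd.pow_const _))
    have h3 : ∫⁻ x in A, ∫⁻ y in A, B.indicator 1 (x, y) / edist x y ^ ((m : ℝ) + 1)
        ∂μHE[m] ∂μHE[m] ≤ ∫⁻ x, ∫⁻ y in {y | r ≤ edist (u x) (u y)},
        1 / edist x y ^ ((m : ℝ) + 1) ∂μHE[m] ∂μHE[m] := by
      refine (setLIntegral_le_lintegral _ _).trans (lintegral_mono fun x ↦ ?_)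
      refine (setLIntegral_le_lintegral _ _).trans ?_
      have hset : MeasurableSet {y | r ≤ edist (u x) (u y)} := measurable_prodMk_left hBm
      rw [← lintegral_indicator hset]
      refine lintegral_mono fun y ↦ ?_
      by_cases hxy : r ≤ edist (u x) (u y)
      · simp [hB, hxy]
      · simp [hB, hxy]
    refine (h1.trans_lt (ENNReal.mul_lt_top ?_ (h2.trans_lt (ENNReal.mul_lt_top ?_
      (h3.trans_lt hX))))).ne
    · exact (ENNReal.rpow_ne_top_of_nonneg (by positivity) ENNReal.coe_ne_top).lt_top
    · exact hKmt.lt_top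
  have hmain := lintegral_indicator_div_edist_le (μ := volume) h.convex h.measurableSet_dom
    (hGm hBm) (hGm hDm) hmid hfin hsp
  rw [hfr] at hmain
  have hDv : ∀ x y, D.indicator (1 : M × M → ℝ≥0∞) (x, y) ≤ c * edist (v x) (v y) ^ p := by
    intro x y
    by_cases hxy : (x, y) ∈ D
    · obtain ⟨hD1, hD2⟩ := hxy
      have hr0 : r ≠ 0 := (pos_of_gt hD2).ne'
      have hrt : r ≠ ⊤ := by
        rintro rfl
        rw [ENNReal.top_div_of_ne_top (by simp)] at hD1
        exact hD2.ne (top_le_iff.1 hD1)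
      simp only at hD1 hD2
      rw [huv x y hD2, hc, if_neg hr0, ← ENNReal.mul_rpow_of_nonneg _ _ hp.le]
      refine (indicator_le_self' (fun _ _ ↦ zero_le) _).trans ?_
      refine ENNReal.one_le_rpow ?_ hp
      calc (1 : ℝ≥0∞) = 2 / r * (r / 2) := by
            rw [div_eq_mul_inv, div_eq_mul_inv, mul_mul_mul_comm, mul_comm (r⁻¹),
              mul_mul_mul_comm, ENNReal.mul_inv_cancel hr0 hrt,
              ENNReal.mul_inv_cancel (by simp) (by simp), one_mul]
        _ ≤ _ := by gcongr
    · rw [indicator_of_notMem hxy]; exact zero_le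
  -- On `B` the truncation bounds the numerator by 1; off `B` the increments of `u` and `v` agree.
  have hpt : ∀ x y, min (edist (u y) (u x) ^ p) 1 / edist y x ^ α
      ≤ B.indicator 1 (x, y) / edist x y ^ α + edist (v y) (v x) ^ p / edist y x ^ α := by
    intro x y
    rw [edist_comm x y, ← ENNReal.add_div]
    gcongr
    by_cases hxy : (x, y) ∈ B
    · rw [indicator_of_mem hxy]
      exact (min_le_right _ _).trans le_self_add
    · rw [indicator_of_notMem hxy, zero_add, edist_comm (v y), huv x y (not_le.1 hxy),
        edist_comm (u y)]
      exact min_le_left _ _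
  have hBint : ∫⁻ x in A, ∫⁻ y in A, B.indicator 1 (x, y) / edist x y ^ α ∂μHE[m] ∂μHE[m]
      ≤ Km * (K ^ α * (scalingConst (s * p) * (c * (K ^ α * Km)))) * gagliardoEnergy m s p v := by
    calc _ ≤ Km * ∫⁻ x in U, ∫⁻ y in U, B.indicator 1 (g x, g y) / edist (g x) (g y) ^ α :=
          h.lintegral_lintegral_le _
      _ ≤ Km * (K ^ α * ∫⁻ x in U, ∫⁻ y in U, (G ⁻¹' B).indicator 1 (x, y) / edist x y ^ α) := by
          gcongr
          exact mono2 hKα fun x hx y hy ↦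
            ENNReal.div_rpow_le_mul_div_rpow h.pos (h.edist_le x hx y hy) hα0
      _ ≤ Km * (K ^ α * (scalingConst (s * p) * ∫⁻ x in U, ∫⁻ y in U,
            (G ⁻¹' D).indicator 1 (x, y) / edist x y ^ α)) := by gcongr
      _ ≤ Km * (K ^ α * (scalingConst (s * p) * (c * ∫⁻ x in U, ∫⁻ y in U,
            edist (v (g x)) (v (g y)) ^ p / edist x y ^ α))) := by
          gcongr
          refine mono2 hct fun x hx y hy ↦ ?_
          rw [← mul_div_assoc]
          gcongr
          exact hDv _ _
      _ ≤ Km * (K ^ α * (scalingConst (s * p) * (c * (K ^ α * ∫⁻ x in U, ∫⁻ y in U,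
            edist (v (g x)) (v (g y)) ^ p / edist (g x) (g y) ^ α)))) := by
          gcongr
          exact mono2 hKα fun x hx y hy ↦
            ENNReal.div_rpow_le_mul_div_rpow h.pos (hlip x hx y hy) hα0
      _ ≤ Km * (K ^ α * (scalingConst (s * p) * (c * (K ^ α * (Km *
            gagliardoEnergy m s p v))))) := by
          gcongr
          refine (h.lintegral_lintegral_comp_le
            (f := fun x y ↦ edist (v x) (v y) ^ p / edist x y ^ α)
            ((hvd.pow_const _).div (hMd.pow_const _))).trans ?_
          gcongr
          refine (setLIntegral_le_lintegral _ _).trans (lintegral_mono fun x ↦ ?_)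
          refine (setLIntegral_le_lintegral _ _).trans (lintegral_mono fun y ↦ ?_)
          rw [edist_comm x y, edist_comm (v x)]
      _ = _ := by ring
  calc _ ≤ ∫⁻ x in A, ((∫⁻ y in A, B.indicator 1 (x, y) / edist x y ^ α ∂μHE[m]) +
          ∫⁻ y in A, edist (v y) (v x) ^ p / edist y x ^ α ∂μHE[m]) ∂μHE[m] := by
        refine lintegral_mono fun x ↦ ?_
        rw [← lintegral_add_left]
        · exact lintegral_mono fun y ↦ hpt x y
        · exact ((measurable_one.indicator hBm).div (hMd.pow_const _)).comp measurable_prodMk_left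
    _ = (∫⁻ x in A, ∫⁻ y in A, B.indicator 1 (x, y) / edist x y ^ α ∂μHE[m] ∂μHE[m]) +
          ∫⁻ x in A, ∫⁻ y in A, edist (v y) (v x) ^ p / edist y x ^ α ∂μHE[m] ∂μHE[m] := by
        have : IsFiniteMeasure ((μHE[m] : Measure M).restrict A) :=
          isFiniteMeasure_restrict.2 h.measure_lt_top.ne
        rw [lintegral_add_left]
        exact Measurable.lintegral_prod_right
          ((measurable_one.indicator hBm).div (hMd.pow_const _))
    _ ≤ C * gagliardoEnergy m s p v := by
        rw [hC, add_mul, one_mul]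
        refine add_le_add hBint ?_
        refine (setLIntegral_le_lintegral _ _).trans (lintegral_mono fun x ↦ ?_)
        exact setLIntegral_le_lintegral _ _

end IsConvexPatch

end LocalEstimate

/-! ### Propagation of local integral bounds -/

section Chaining

open Filter Topology

variable {X ι : Type*} [MeasurableSpace X] {μ : Measure X} {φ : ι → X → X → ℝ≥0∞} {e : ι → ℝ≥0∞}

/-- The integrals over `A ×ˢ B` of the functions `φ i` are controlled, uniformly in `i`, by
the numbers `e i`. -/
def IsControlledOn (μ : Measure X) (φ : ι → X → X → ℝ≥0∞) (e : ι → ℝ≥0∞) (A B : Set X) : Prop :=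
  ∃ C : ℝ≥0, ∀ i, ∫⁻ x in A, ∫⁻ y in B, φ i x y ∂μ ∂μ ≤ C * e i

namespace IsControlledOn

lemma mono {A B A' B' : Set X} (h : IsControlledOn μ φ e A B) (hA : A' ⊆ A) (hB : B' ⊆ B) :
    IsControlledOn μ φ e A' B' := by
  obtain ⟨C, hC⟩ := h
  refine ⟨C, fun i ↦ le_trans ?_ (hC i)⟩
  exact (lintegral_mono_set hA).trans (lintegral_mono fun x ↦ lintegral_mono_set hB)

/-- Average the quasi-triangle inequality over the intermediate point y in `B`, then divide by the
measure of `B`. -/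
lemma trans [IsFiniteMeasure μ] (hφ : ∀ i, Measurable (Function.uncurry (φ i))) {c : ℝ≥0∞}
    (hc : c ≠ ⊤) (htri : ∀ i x y z, φ i x z ≤ c * (φ i x y + φ i y z)) {A B D : Set X}
    (hAB : IsControlledOn μ φ e A B) (hBD : IsControlledOn μ φ e B D) (hB : μ B ≠ 0) :
    IsControlledOn μ φ e A D := by
  obtain ⟨C₁, hC₁⟩ := hAB
  obtain ⟨C₂, hC₂⟩ := hBD
  have hBt : μ B ≠ ⊤ := measure_ne_top _ _
  set C : ℝ≥0∞ := (μ B)⁻¹ * (c * (μ D * C₁ + μ A * C₂)) with hC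
  have hCt : C ≠ ⊤ := by
    refine ENNReal.mul_ne_top (ENNReal.inv_ne_top.2 hB) (ENNReal.mul_ne_top hc ?_)
    exact ENNReal.add_ne_top.2 ⟨ENNReal.mul_ne_top (measure_ne_top _ _) ENNReal.coe_ne_top,
      ENNReal.mul_ne_top (measure_ne_top _ _) ENNReal.coe_ne_top⟩
  refine ⟨C.toNNReal, fun i ↦ ?_⟩
  rw [ENNReal.coe_toNNReal hCt]
  have hm1 : ∀ x, Measurable (φ i x) := fun x ↦ (hφ i).of_uncurry_left
  have hm2 : ∀ z, Measurable fun y ↦ φ i y z := fun z ↦ (hφ i).of_uncurry_right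
  have key : μ B * ∫⁻ x in A, ∫⁻ z in D, φ i x z ∂μ ∂μ ≤ c * (μ D * (C₁ * e i) + μ A * (C₂ * e i)) :=
    calc μ B * ∫⁻ x in A, ∫⁻ z in D, φ i x z ∂μ ∂μ
        = ∫⁻ x in A, ∫⁻ z in D, ∫⁻ _ in B, φ i x z ∂μ ∂μ ∂μ := by
          simp_rw [lintegral_const, Measure.restrict_apply_univ, lintegral_mul_const' _ _ hBt]
          rw [mul_comm]
      _ ≤ ∫⁻ x in A, ∫⁻ z in D, ∫⁻ y in B, c * (φ i x y + φ i y z) ∂μ ∂μ ∂μ :=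
          lintegral_mono fun x ↦ lintegral_mono fun z ↦ lintegral_mono fun y ↦ htri i x y z
      _ = ∫⁻ x in A, ∫⁻ z in D, c * ((∫⁻ y in B, φ i x y ∂μ) + ∫⁻ y in B, φ i y z ∂μ) ∂μ ∂μ := by
          refine lintegral_congr fun x ↦ lintegral_congr fun z ↦ ?_
          rw [lintegral_const_mul' _ _ hc, lintegral_add_left (hm1 x)]
      _ = ∫⁻ x in A, c * (μ D * (∫⁻ y in B, φ i x y ∂μ) +
            ∫⁻ z in D, ∫⁻ y in B, φ i y z ∂μ ∂μ) ∂μ := by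
          refine lintegral_congr fun x ↦ ?_
          rw [lintegral_const_mul' _ _ hc, lintegral_add_left measurable_const, lintegral_const,
            Measure.restrict_apply_univ, mul_comm (μ D)]
      _ = c * (μ D * (∫⁻ x in A, ∫⁻ y in B, φ i x y ∂μ ∂μ) +
            μ A * ∫⁻ z in D, ∫⁻ y in B, φ i y z ∂μ ∂μ) := by
          rw [lintegral_const_mul' _ _ hc, lintegral_add_right _ measurable_const,
            lintegral_const, lintegral_const_mul' _ _ (measure_ne_top _ _),
            Measure.restrict_apply_univ, mul_comm (μ A)]
      _ ≤ c * (μ D * (C₁ * e i) + μ A * (C₂ * e i)) := by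
          gcongr
          · exact hC₁ i
          · refine le_of_eq_of_le (lintegral_lintegral_swap ?_) (hC₂ i)
            exact ((hφ i).comp measurable_swap).aemeasurable
  calc ∫⁻ x in A, ∫⁻ z in D, φ i x z ∂μ ∂μ
      = (μ B)⁻¹ * (μ B * ∫⁻ x in A, ∫⁻ z in D, φ i x z ∂μ ∂μ) := by
        rw [← mul_assoc, ENNReal.inv_mul_cancel hB hBt, one_mul]
    _ ≤ (μ B)⁻¹ * (c * (μ D * (C₁ * e i) + μ A * (C₂ * e i))) := by gcongr
    _ = C * e i := by rw [hC]; ring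

/-- Local control propagates along preconnected sets. -/
lemma of_isPreconnected [TopologicalSpace X] [IsFiniteMeasure μ] [μ.IsOpenPosMeasure]
    (hφ : ∀ i, Measurable (Function.uncurry (φ i))) {c : ℝ≥0∞} (hc : c ≠ ⊤)
    (htri : ∀ i x y z, φ i x z ≤ c * (φ i x y + φ i y z))
    (hloc : ∀ x, ∃ A ∈ 𝓝 x, IsControlledOn μ φ e A A) {S : Set X} (hS : IsPreconnected S) {x y : X}
    (hx : x ∈ S) (hy : y ∈ S) : ∃ A ∈ 𝓝 x, ∃ B ∈ 𝓝 y, IsControlledOn μ φ e A B := by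
  have htrans : ∀ {y z : X}, (∃ A ∈ 𝓝 x, ∃ B ∈ 𝓝 y, IsControlledOn μ φ e A B) →
      (∃ A ∈ 𝓝 y, ∃ B ∈ 𝓝 z, IsControlledOn μ φ e A B) →
      ∃ A ∈ 𝓝 x, ∃ B ∈ 𝓝 z, IsControlledOn μ φ e A B := by
    rintro y z ⟨A, hA, B, hB, hAB⟩ ⟨B', hB', D, hD, hBD⟩
    refine ⟨A, hA, D, hD, ?_⟩
    -- The intermediate set `B ∩ B'` is a neighborhood of y, hence has positive measure.
    exact trans hφ hc htri (hAB.mono subset_rfl inter_subset_left)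
      (hBD.mono (inter_subset_right (s := B)) subset_rfl)
      (Measure.measure_pos_of_mem_nhds μ (inter_mem hB hB')).ne'
  -- The points that can be reached from x form a clopen set, which therefore contains the whole of
  -- `S`.
  set T : Set X := {y | ∃ A ∈ 𝓝 x, ∃ B ∈ 𝓝 y, IsControlledOn μ φ e A B} with hT
  have hopen : IsOpen T := by
    rw [isOpen_iff_mem_nhds]
    rintro y ⟨A, hA, B, hB, hAB⟩
    filter_upwards [eventually_mem_nhds_iff.2 hB] with z hz
    exact ⟨A, hA, B, hz, hAB⟩
  have hclosed : IsClosed T := by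
    rw [← isOpen_compl_iff, isOpen_iff_mem_nhds]
    intro y hy
    obtain ⟨A, hA, hAA⟩ := hloc y
    filter_upwards [eventually_mem_nhds_iff.2 hA] with z hz hzT
    exact hy (htrans hzT ⟨A, hz, A, hA, hAA⟩)
  obtain ⟨A, hA, hAA⟩ := hloc x
  exact hS.subset_isClopen ⟨hclosed, hopen⟩ ⟨x, hx, A, hA, A, hA, hAA⟩ hy

/-- On a compact space, local control implies global control. -/
lemma univ_of_forall_nhds [TopologicalSpace X] [CompactSpace X] [IsFiniteMeasure μ]
    (hφ : ∀ i, Measurable (Function.uncurry (φ i)))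
    (h : ∀ x y, ∃ A ∈ 𝓝 x, ∃ B ∈ 𝓝 y, IsControlledOn μ φ e A B) :
    IsControlledOn μ φ e univ univ := by
  -- Control passes to subsets and finite unions, so compactness of X × X applies.
  have key : ∃ C : ℝ≥0, ∀ i, ∫⁻ z in univ, φ i z.1 z.2 ∂(μ.prod μ) ≤ C * e i := by
    refine isCompact_univ.induction_on (p := fun S ↦ ∃ C : ℝ≥0, ∀ i,
      ∫⁻ z in S, φ i z.1 z.2 ∂(μ.prod μ) ≤ C * e i) ⟨0, by simp⟩ ?_ ?_ ?_
    · rintro S T hST ⟨C, hC⟩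
      exact ⟨C, fun i ↦ (lintegral_mono_set hST).trans (hC i)⟩
    · rintro S T ⟨C, hC⟩ ⟨C', hC'⟩
      refine ⟨C + C', fun i ↦ (lintegral_union_le _ _ _).trans ?_⟩
      rw [ENNReal.coe_add, add_mul]
      exact add_le_add (hC i) (hC' i)
    · rintro ⟨x, y⟩ -
      obtain ⟨A, hA, B, hB, C, hC⟩ := h x y
      refine ⟨A ×ˢ B, nhdsWithin_le_nhds (prod_mem_nhds hA hB), C, fun i ↦ ?_⟩
      exact (setLIntegral_prod (Function.uncurry (φ i)) (hφ i).aemeasurable).trans_le (hC i)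
  obtain ⟨C, hC⟩ := key
  refine ⟨C, fun i ↦ ?_⟩
  have h1 := lintegral_prod (μ := μ) (ν := μ) (Function.uncurry (φ i)) (hφ i).aemeasurable
  have h2 := hC i
  rw [setLIntegral_univ] at h2
  simp_rw [setLIntegral_univ]
  exact h1.symm.trans_le h2

end IsControlledOn

end Chaining

/-! ### The estimate on a compact manifold -/

section GlobalEstimate

open Filter Topology

/-- If one of the powers on the right reaches 1, the truncation on the left is already dominated;
otherwise this is convexity of t ↦ t^p. -/
lemma ENNReal.min_rpow_one_le_of_le_add {a b c : ℝ≥0∞} (h : c ≤ a + b) {p : ℝ} (hp : 1 ≤ p) :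
    min (c ^ p) 1 ≤ 2 ^ (p - 1) * (min (a ^ p) 1 + min (b ^ p) 1) := by
  have h1 : (1 : ℝ≥0∞) ≤ 2 ^ (p - 1) := by
    rw [← ENNReal.one_rpow (p - 1)]
    exact ENNReal.rpow_le_rpow (by norm_num) (by linarith)
  rcases le_total 1 (a ^ p) with ha | ha
  · rw [min_eq_right ha]
    exact (min_le_right _ _).trans (one_le_mul h1 le_self_add)
  rcases le_total 1 (b ^ p) with hb | hb
  · rw [min_eq_right hb]
    exact (min_le_right _ _).trans (one_le_mul h1 le_add_self)
  rw [min_eq_left ha, min_eq_left hb]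
  refine (min_le_left _ _).trans ?_
  exact (ENNReal.rpow_le_rpow h (by linarith)).trans (ENNReal.rpow_add_le_mul_rpow_add_rpow _ _ hp)

lemma isLocallyFiniteMeasure_euclideanHausdorffMeasure {m : ℕ} {H : Type*}
    [TopologicalSpace H] (I : ModelWithCorners ℝ (EuclideanSpace ℝ (Fin m)) H)
    {M : Type*} [EMetricSpace M] [ChartedSpace H M]
    [RiemannianBundle (fun x : M ↦ TangentSpace I x)] [IsRiemannianManifold I M] [IsManifold I 1 M]
    [IsContinuousRiemannianBundle (EuclideanSpace ℝ (Fin m)) (fun x : M ↦ TangentSpace I x)]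
    [MeasurableSpace M] [BorelSpace M] :
    IsLocallyFiniteMeasure (μHE[m] : Measure M) := by
  refine ⟨fun x ↦ ?_⟩
  obtain ⟨A, hA, -, U, g, K, h⟩ := exists_isConvexPatch I x univ_mem
  exact ⟨A, hA, h.measure_lt_top⟩

lemma isOpenPosMeasure_euclideanHausdorffMeasure {m : ℕ} {H : Type*}
    [TopologicalSpace H] (I : ModelWithCorners ℝ (EuclideanSpace ℝ (Fin m)) H)
    {M : Type*} [EMetricSpace M] [ChartedSpace H M]
    [RiemannianBundle (fun x : M ↦ TangentSpace I x)] [IsRiemannianManifold I M] [IsManifold I 1 M]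
    [IsContinuousRiemannianBundle (EuclideanSpace ℝ (Fin m)) (fun x : M ↦ TangentSpace I x)]
    [MeasurableSpace M] [BorelSpace M] :
    (μHE[m] : Measure M).IsOpenPosMeasure := by
  refine ⟨fun O hO ⟨x, hx⟩ ↦ ?_⟩
  obtain ⟨A, hA, hAO, U, g, K, h⟩ := exists_isConvexPatch I x (hO.mem_nhds hx)
  exact (h.measure_pos.trans_le (measure_mono hAO)).ne'

lemma exists_isPreconnected_of_edist_ne_top {m : ℕ} {H : Type*}
    [TopologicalSpace H] (I : ModelWithCorners ℝ (EuclideanSpace ℝ (Fin m)) H)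
    {M : Type*} [EMetricSpace M] [ChartedSpace H M]
    [RiemannianBundle (fun x : M ↦ TangentSpace I x)] [IsRiemannianManifold I M]
    {x y : M} (h : edist x y ≠ ⊤) :
    ∃ S : Set M, IsPreconnected S ∧ x ∈ S ∧ y ∈ S := by
  rw [IsRiemannianManifold.out (I := I)] at h
  obtain ⟨γ, hγ0, hγ1, hγ, -⟩ :=
    exists_lt_locally_constant_of_riemannianEDist_lt h.lt_top zero_lt_one
  exact ⟨γ '' Icc 0 1, isPreconnected_Icc.image _ hγ.continuous.continuousOn,
    ⟨0, by simp, hγ0⟩, ⟨1, by simp, hγ1⟩⟩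

/-- The global estimate on a compact Riemannian manifold, for maps `u` and `v` whose increments
coincide when those of `u` are smaller than `r`. -/
theorem exists_truncatedEnergy_le {m : ℕ} {H : Type*}
    [TopologicalSpace H] (I : ModelWithCorners ℝ (EuclideanSpace ℝ (Fin m)) H)
    {M : Type*} [EMetricSpace M] [ChartedSpace H M]
    [RiemannianBundle (fun x : M ↦ TangentSpace I x)] [IsRiemannianManifold I M] [IsManifold I 1 M]
    [IsContinuousRiemannianBundle (EuclideanSpace ℝ (Fin m)) (fun x : M ↦ TangentSpace I x)]
    [MeasurableSpace M] [BorelSpace M]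
    [CompactSpace M] {Y Y' : Type*} [EMetricSpace Y]
    [EMetricSpace Y'] [MeasurableSpace Y] [BorelSpace Y] [SecondCountableTopology Y]
    [MeasurableSpace Y'] [BorelSpace Y'] [SecondCountableTopology Y'] {s p : ℝ} (hp : 1 < p)
    (hsp : 1 < s * p) (r : ℝ≥0∞) :
    ∃ C : ℝ≥0, ∀ (u : M → Y') (v : M → Y), Measurable u → Measurable v →
      (∀ x y, edist (u x) (u y) < r → edist (v x) (v y) = edist (u x) (u y)) →
      ∫⁻ x, ∫⁻ y in {y | r ≤ edist (u x) (u y)},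
        1 / edist x y ^ ((m : ℝ) + 1) ∂μHE[m] ∂μHE[m] < ⊤ →
      truncatedEnergy m s p u ≤ C * gagliardoEnergy m s p v := by
  have : IsLocallyFiniteMeasure (μHE[m] : Measure M) :=
    isLocallyFiniteMeasure_euclideanHausdorffMeasure I
  have : (μHE[m] : Measure M).IsOpenPosMeasure := isOpenPosMeasure_euclideanHausdorffMeasure I
  have : SecondCountableTopology M := EMetric.secondCountable_of_sigmaCompact M
  have : IsFiniteMeasure (μHE[m] : Measure M) := CompactSpace.isFiniteMeasure
  set α : ℝ := (m : ℝ) + s * p with hα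
  have hα0 : 0 < α := by positivity
  -- Indexing by all admissible pairs of maps makes every constant in the chaining independent of
  -- the maps.
  let ι := {w : (M → Y') × (M → Y) // Measurable w.1 ∧ Measurable w.2 ∧
    (∀ x y, edist (w.1 x) (w.1 y) < r → edist (w.2 x) (w.2 y) = edist (w.1 x) (w.1 y)) ∧
    ∫⁻ x, ∫⁻ y in {y | r ≤ edist (w.1 x) (w.1 y)},
        1 / edist x y ^ ((m : ℝ) + 1) ∂μHE[m] ∂μHE[m] < ⊤}
  -- Chaining is done for the numerator `φ`, which has a quasi-triangle inequality; the full
  -- integrand `ψ` is handled near each pair of points.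
  let φ : ι → M → M → ℝ≥0∞ := fun w x y ↦ min (edist (w.1.1 y) (w.1.1 x) ^ p) 1
  let ψ : ι → M → M → ℝ≥0∞ := fun w x y ↦ φ w x y / edist y x ^ α
  let e : ι → ℝ≥0∞ := fun w ↦ gagliardoEnergy m s p w.1.2
  have hφm : ∀ w, Measurable (Function.uncurry (φ w)) := fun w ↦
    (((w.2.1.comp measurable_snd).edist (w.2.1.comp measurable_fst)).pow_const p).min
      measurable_const
  have hψm : ∀ w, Measurable (Function.uncurry (ψ w)) := fun w ↦
    (hφm w).div ((measurable_snd.edist measurable_fst).pow_const _)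
  have htri : ∀ w x y z, φ w x z ≤ 2 ^ (p - 1) * (φ w x y + φ w y z) := by
    intro w x y z
    refine ENNReal.min_rpow_one_le_of_le_add ?_ hp.le
    exact (edist_triangle _ _ _).trans_eq (add_comm _ _)
  have hloc : ∀ x, ∃ A ∈ 𝓝 x, A ⊆ Metric.eball x 1 ∧ MeasurableSet A ∧
      IsControlledOn μHE[m] ψ e A A := by
    intro x
    obtain ⟨A, hA, hA1, U, g, K, h⟩ := exists_isConvexPatch I x (Metric.eball_mem_nhds x one_pos)
    obtain ⟨C, hC⟩ := h.exists_lintegral_le (Y := Y) (Y' := Y') (zero_lt_one.trans hp) hsp r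
    exact ⟨A, hA, hA1, h.measurableSet, C, fun w ↦ hC _ _ w.2.1 w.2.2.1 w.2.2.2.1 w.2.2.2.2⟩
  -- Two points of a unit ball are at distance at most 2, so there the kernel is at least 2^(-α).
  have hlocφ : ∀ x, ∃ A ∈ 𝓝 x, IsControlledOn μHE[m] φ e A A := by
    intro x
    obtain ⟨A, hA, hA1, hAm, C, hC⟩ := hloc x
    have h2 : (2 : ℝ≥0∞) ^ α ≠ ⊤ := ENNReal.rpow_ne_top_of_nonneg hα0.le (by simp)
    refine ⟨A, hA, ((2 : ℝ≥0∞) ^ α).toNNReal * C, fun w ↦ ?_⟩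
    rw [ENNReal.coe_mul, ENNReal.coe_toNNReal h2, mul_assoc]
    refine le_trans ?_ (mul_le_mul_right (hC w) _)
    rw [← lintegral_const_mul' _ _ h2]
    refine setLIntegral_mono' hAm fun y hy ↦ ?_
    rw [← lintegral_const_mul' _ _ h2]
    refine setLIntegral_mono' hAm fun z hz ↦ ?_
    have hyz : edist z y ≤ 2 := by
      refine (edist_triangle_right z y x).trans ?_
      rw [← one_add_one_eq_two]
      exact add_le_add (hA1 hz).le (hA1 hy).le
    calc φ w y z = 2 ^ α * (φ w y z / 2 ^ α) :=
          (ENNReal.mul_div_cancel (ENNReal.rpow_pos (by simp) (by simp)).ne' h2).symm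
      _ ≤ 2 ^ α * ψ w y z := by
          gcongr
          exact ENNReal.div_le_div_left (ENNReal.rpow_le_rpow hyz hα0.le) _
  have hglob : IsControlledOn μHE[m] ψ e univ univ := by
    refine IsControlledOn.univ_of_forall_nhds hψm fun x y ↦ ?_
    by_cases hxy : x = y
    · obtain ⟨A, hA, -, -, hAA⟩ := hloc x
      exact ⟨A, hA, A, hxy ▸ hA, hAA⟩
    by_cases htop : edist x y = ⊤
    -- Unit balls around points at infinite distance are at infinite distance from each other, and
    -- the kernel vanishes between them.
    · refine ⟨_, Metric.eball_mem_nhds x one_pos, _, Metric.eball_mem_nhds y one_pos, 0,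
        fun w ↦ ?_⟩
      rw [setLIntegral_congr_fun (g := 0) Metric.isOpen_eball.measurableSet]
      · simp
      intro a ha
      simp only [Pi.zero_apply]
      rw [setLIntegral_congr_fun (g := 0) Metric.isOpen_eball.measurableSet]
      · simp
      intro b hb
      have hab : edist b a = ⊤ := by
        by_contra hab
        refine (edist_triangle4 x a b y).not_gt ?_
        rw [htop, edist_comm x a, edist_comm a b]
        exact ENNReal.add_lt_top.2 ⟨ENNReal.add_lt_top.2 ⟨lt_trans ha ENNReal.one_lt_top,
          lt_top_iff_ne_top.2 hab⟩, lt_trans hb ENNReal.one_lt_top⟩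
      simp [ψ, hab, hα0]
    obtain ⟨S, hS, hxS, hyS⟩ := exists_isPreconnected_of_edist_ne_top I htop
    obtain ⟨A, hA, B, hB, C, hC⟩ := IsControlledOn.of_isPreconnected hφm
      (ENNReal.rpow_ne_top_of_nonneg (by linarith) (by simp)) htri hlocφ hS hxS hyS
    -- Shrinking the neighborhoods to radius δ/4 keeps their points δ/2 apart, which bounds the
    -- kernel by (δ/2)^(-α).
    set δ := edist x y with hδ
    have hδ0 : δ ≠ 0 := by simpa [hδ] using hxy
    have hδ4 : 0 < δ / 2 / 2 := ENNReal.half_pos (ENNReal.half_pos hδ0).ne'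
    have hk0 : (δ / 2) ^ α ≠ 0 :=
      (ENNReal.rpow_pos (ENNReal.half_pos hδ0) (ENNReal.div_ne_top htop (by simp))).ne'
    have hinv : ((δ / 2) ^ α)⁻¹ ≠ ⊤ := ENNReal.inv_ne_top.2 hk0
    obtain ⟨A', hA', hA'o, hxA'⟩ := mem_nhds_iff.1
      (inter_mem hA (Metric.eball_mem_nhds x hδ4))
    obtain ⟨B', hB', hB'o, hyB'⟩ := mem_nhds_iff.1
      (inter_mem hB (Metric.eball_mem_nhds y hδ4))
    refine ⟨A', hA'o.mem_nhds hxA', B', hB'o.mem_nhds hyB', ((δ / 2) ^ α)⁻¹.toNNReal * C,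
      fun w ↦ ?_⟩
    rw [ENNReal.coe_mul, ENNReal.coe_toNNReal hinv, mul_assoc]
    refine le_trans ?_ (mul_le_mul_right ((lintegral_mono_set (hA'.trans inter_subset_left)).trans
      ((lintegral_mono fun a ↦ lintegral_mono_set (hB'.trans inter_subset_left)).trans (hC w))) _)
    rw [← lintegral_const_mul' _ _ hinv]
    refine setLIntegral_mono' hA'o.measurableSet fun a ha ↦ ?_
    rw [← lintegral_const_mul' _ _ hinv]
    refine setLIntegral_mono' hB'o.measurableSet fun b hb ↦ ?_
    have hab : δ / 2 ≤ edist b a := by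
      by_contra! hlt
      refine (edist_triangle4 x a b y).not_gt ?_
      rw [edist_comm x a, edist_comm a b, ← hδ]
      calc edist a x + edist b a + edist b y < δ / 2 / 2 + δ / 2 + δ / 2 / 2 :=
            ENNReal.add_lt_add (ENNReal.add_lt_add (hA' ha).2 hlt) (hB' hb).2
        _ = δ := by rw [add_right_comm, ENNReal.add_halves, ENNReal.add_halves]
    calc ψ w a b ≤ φ w a b / (δ / 2) ^ α := by
          simp only [ψ]
          gcongr
      _ = ((δ / 2) ^ α)⁻¹ * φ w a b := by rw [div_eq_mul_inv, mul_comm]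
  obtain ⟨C, hC⟩ := hglob
  refine ⟨C, fun u v hu hv huv hX ↦ ?_⟩
  have := hC ⟨(u, v), hu, hv, huv, hX⟩
  rw [setLIntegral_univ] at this
  simp_rw [setLIntegral_univ] at this
  exact this

end GlobalEstimate

/-! ### Metric coverings and minimizing geodesics -/

section MetricGeometry

open Filter Topology

variable {X Y : Type*} [EMetricSpace X] [EMetricSpace Y]

variable (X) in
/-- Any two points at finite distance are joined, up to arbitrarily small errors, by a curve that is
parametrized by the distance to its origin and is almost minimizing. -/
def HasAlmostGeodesics : Prop :=
  ∀ (a b : X) (L : ℝ≥0∞), edist a b < L → ∃ f : ℝ≥0∞ → X,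
    (∀ s ≤ edist a b, edist a (f s) = s) ∧
    ∀ s ≤ edist a b, ∀ t ≤ edist a b, s + edist (f s) (f t) + edist (f t) b ≤ L ∨
      t + edist (f s) (f t) + edist (f s) b ≤ L

variable (X) in
/-- Balls are preconnected, in a pointed form. -/
def HasPreconnectedBalls : Prop :=
  ∀ (a b : X) (r : ℝ≥0∞), edist a b < r → ∃ S ⊆ Metric.eball a r, IsPreconnected S ∧ a ∈ S ∧ b ∈ S

/-- In a space with almost geodesics where all balls of some fixed radius are compact, all closed
balls are compact. -/
lemma HasAlmostGeodesics.isCompact_closedEBall (hX : HasAlmostGeodesics X) {ρ : ℝ≥0} (hρ : 0 < ρ)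
    (hc : ∀ a : X, IsCompact (Metric.closedEBall a ρ)) (a : X) (R : ℝ≥0) :
    IsCompact (Metric.closedEBall a R) := by
  -- The radius grows by ρ/2. A point of the larger ball is within 3ρ/4 of the smaller one, which
  -- finitely many balls of radius ρ/4 cover; hence finitely many compact balls of radius ρ cover
  -- the larger ball.
  have key : ∀ k : ℕ, IsCompact (Metric.closedEBall a (k * (ρ / 2) : ℝ≥0)) := by
    intro k
    induction k with
    | zero => simp
    | succ k ih =>
      set R : ℝ≥0 := k * (ρ / 2) with hR
      have hρ4 : 0 < ρ / 4 := by positivity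
      obtain ⟨T, hT, hTfin, hcov⟩ := ih.elim_finite_subcover_image (b := univ)
        (c := fun c ↦ Metric.eball c (ρ / 4 : ℝ≥0)) (fun _ _ ↦ Metric.isOpen_eball)
        (fun x _ ↦ mem_iUnion₂.2 ⟨x, mem_univ _, Metric.mem_eball_self (ENNReal.coe_pos.2 hρ4)⟩)
      refine (hTfin.isCompact_biUnion fun c _ ↦ hc c).of_isClosed_subset
        Metric.isClosed_closedEBall ?_
      intro b hb
      have hb' : edist a b ≤ ((R + ρ / 2 : ℝ≥0) : ℝ≥0∞) := by
        rw [Metric.mem_closedEBall, edist_comm] at hb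
        convert! hb using 2
        rw [hR]; push_cast; ring
      have hlt : edist a b < ((R + (ρ / 2 + ρ / 4) : ℝ≥0) : ℝ≥0∞) := by
        refine hb'.trans_lt (ENNReal.coe_lt_coe.2 ?_)
        rw [← add_assoc]
        exact lt_add_of_pos_right _ hρ4
      have : ∃ b' ∈ Metric.closedEBall a R, edist b' b ≤ ((ρ / 2 + ρ / 4 : ℝ≥0) : ℝ≥0∞) := by
        rcases le_total (edist a b) R with h | h
        · exact ⟨b, by rwa [Metric.mem_closedEBall, edist_comm], by simp⟩
        · obtain ⟨f, hf1, hf2⟩ := hX a b _ hlt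
          refine ⟨f R, by rw [Metric.mem_closedEBall, edist_comm, hf1 _ h], ?_⟩
          have h2 := hf2 R h R h
          rw [or_self, edist_self, add_zero, ENNReal.coe_add] at h2
          exact (ENNReal.add_le_add_iff_left ENNReal.coe_ne_top).1 h2
      obtain ⟨b', hb'1, hb'2⟩ := this
      obtain ⟨c, hcT, hcb⟩ := mem_iUnion₂.1 (hcov hb'1)
      refine mem_iUnion₂.2 ⟨c, hcT, ?_⟩
      rw [Metric.mem_closedEBall, edist_comm]
      rw [Metric.mem_eball, edist_comm] at hcb
      refine (edist_triangle c b' b).trans ((add_le_add hcb.le hb'2).trans ?_)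
      rw [← ENNReal.coe_add, ENNReal.coe_le_coe]
      apply le_of_eq
      rw [← NNReal.coe_inj]; push_cast; ring
  obtain ⟨k, hk⟩ := exists_nat_ge (R / (ρ / 2))
  refine (key k).of_isClosed_subset Metric.isClosed_closedEBall
    (Metric.closedEBall_subset_closedEBall ?_)
  rw [ENNReal.coe_le_coe]
  rwa [div_le_iff₀ (by positivity)] at hk

/-- Existence of minimizing geodesics. -/
lemma HasAlmostGeodesics.exists_geodesic (hX : HasAlmostGeodesics X)
    (hc : ∀ (a : X) (R : ℝ≥0), IsCompact (Metric.closedEBall a R)) {a b : X} {ℓ : ℝ} (hℓ : 0 ≤ ℓ)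
    (hab : edist a b = ENNReal.ofReal ℓ) :
    ∃ γ : ℝ → X, γ 0 = a ∧ γ ℓ = b ∧ ∀ s ∈ Icc 0 ℓ, ∀ t ∈ Icc 0 ℓ,
      edist (γ s) (γ t) = ENNReal.ofReal |s - t| := by
  classical
  have hε : ∀ k : ℕ, edist a b < ENNReal.ofReal (ℓ + 1 / (k + 1)) := by
    intro k
    rw [hab]
    have : (0 : ℝ) < 1 / (k + 1) := by positivity
    exact (ENNReal.ofReal_lt_ofReal_iff (by linarith)).2 (by linarith)
  choose f hf1 hf2 using fun k ↦ hX a b _ (hε k)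
  have hle : ∀ s ∈ Icc 0 ℓ, ENNReal.ofReal s ≤ edist a b := fun s hs ↦ by
    rw [hab]; exact ENNReal.ofReal_le_ofReal hs.2
  let F : ℕ → ℝ → X := fun k s ↦ if s ∈ Icc 0 ℓ then f k (ENNReal.ofReal s) else a
  have hF : ∀ k, ∀ s ∈ Icc 0 ℓ, F k s = f k (ENNReal.ofReal s) := fun k s hs ↦ if_pos hs
  have hFK : ∀ k, F k ∈ univ.pi (fun _ : ℝ ↦ Metric.closedEBall a ℓ.toNNReal) := by
    intro k s _
    simp only [F]
    split_ifs with hs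
    · rw [Metric.mem_closedEBall, edist_comm, hf1 k _ (hle s hs)]
      exact ENNReal.ofReal_le_ofReal hs.2
    · exact Metric.mem_closedEBall_self
  have hFle : ∀ k, ∀ s ∈ Icc 0 ℓ, ∀ t ∈ Icc 0 ℓ,
      edist (F k s) (F k t) ≤ ENNReal.ofReal (|s - t| + 1 / (k + 1)) := by
    intro k
    -- Subtracting ℓ ≤ t + d(f(t), b) from the almost-minimizing inequality leaves d ≤ t - s + 1/(k
    -- + 1).
    have aux : ∀ s ∈ Icc 0 ℓ, ∀ t ∈ Icc 0 ℓ, ∀ d, ENNReal.ofReal s + d +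
        edist (f k (ENNReal.ofReal t)) b ≤ ENNReal.ofReal (ℓ + 1 / (k + 1)) →
        d ≤ ENNReal.ofReal (|s - t| + 1 / (k + 1)) := by
      intro s hs t ht d h
      have h1 : edist a b ≤ ENNReal.ofReal t + edist (f k (ENNReal.ofReal t)) b := by
        calc _ ≤ _ := edist_triangle a (f k (ENNReal.ofReal t)) b
          _ = _ := by rw [hf1 k _ (hle t ht)]
      have hk : (0 : ℝ) < 1 / (k + 1) := by positivity
      have h2 : ENNReal.ofReal s + ENNReal.ofReal ℓ + d
          ≤ ENNReal.ofReal (ℓ + 1 / (k + 1)) + ENNReal.ofReal t := by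
        rw [← hab]
        calc _ ≤ ENNReal.ofReal s + (ENNReal.ofReal t + edist (f k (ENNReal.ofReal t)) b) + d := by
              gcongr
          _ = ENNReal.ofReal s + d + edist (f k (ENNReal.ofReal t)) b + ENNReal.ofReal t := by ring
          _ ≤ _ := by gcongr
      rw [← ENNReal.ofReal_add hs.1 hℓ, ← ENNReal.ofReal_add (by linarith) ht.1] at h2
      have h3 : ENNReal.ofReal (s + ℓ) + d
          ≤ ENNReal.ofReal (s + ℓ) + ENNReal.ofReal (|s - t| + 1 / (k + 1)) := by
        rw [← ENNReal.ofReal_add (by linarith [hs.1]) (by positivity)]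
        refine h2.trans (ENNReal.ofReal_le_ofReal ?_)
        have := neg_abs_le (s - t)
        linarith
      exact (ENNReal.add_le_add_iff_left ENNReal.ofReal_ne_top).1 h3
    intro s hs t ht
    rw [hF k s hs, hF k t ht]
    rcases hf2 k _ (hle s hs) _ (hle t ht) with h | h
    · exact aux s hs t ht _ h
    · rw [abs_sub_comm]
      exact aux t ht s hs _ h
  -- Tychonoff's theorem and an ultrafilter give a pointwise limit of the almost geodesics, without
  -- any continuity of them.
  obtain ⟨γ, -, hγ⟩ := (isCompact_univ_pi fun _ : ℝ ↦ hc a ℓ.toNNReal).ultrafilter_le_nhds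
    ((hyperfilter ℕ).map F) (by
      rw [Ultrafilter.coe_map, le_principal_iff]
      exact Filter.mem_map.2 (Filter.Eventually.of_forall hFK))
  have hlim : ∀ s, Tendsto (fun k ↦ F k s) (hyperfilter ℕ) (𝓝 (γ s)) :=
    tendsto_pi_nhds.1 (show Tendsto F (hyperfilter ℕ) (𝓝 γ) from hγ)
  have hzero : ∀ c : ℝ, Tendsto (fun k : ℕ ↦ ENNReal.ofReal (c + 1 / (k + 1))) (hyperfilter ℕ)
      (𝓝 (ENNReal.ofReal c)) := by
    intro c
    refine (ENNReal.tendsto_ofReal ?_).mono_left Nat.hyperfilter_le_atTop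
    simpa using tendsto_const_nhds.add (tendsto_one_div_add_atTop_nhds_zero_nat (𝕜 := ℝ))
  have hγle : ∀ s ∈ Icc 0 ℓ, ∀ t ∈ Icc 0 ℓ, edist (γ s) (γ t) ≤ ENNReal.ofReal |s - t| :=
    fun s hs t ht ↦ le_of_tendsto_of_tendsto' ((hlim s).edist (hlim t)) (hzero _)
      fun k ↦ hFle k s hs t ht
  have h0 : (0 : ℝ) ∈ Icc 0 ℓ := ⟨le_rfl, hℓ⟩
  have h1 : ℓ ∈ Icc 0 ℓ := ⟨hℓ, le_rfl⟩
  have hγ0 : γ 0 = a := by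
    have : ∀ k, F k 0 = a := fun k ↦ by
      have := hf1 k _ (hle 0 h0)
      rw [hF k 0 h0, ← edist_eq_zero, edist_comm, this, ENNReal.ofReal_zero]
    have h := hlim 0
    simp_rw [this] at h
    exact tendsto_nhds_unique h tendsto_const_nhds
  have hγ1 : γ ℓ = b := by
    have : ∀ k, edist (F k ℓ) b ≤ ENNReal.ofReal (0 + 1 / (k + 1)) := fun k ↦ by
      have h := hf2 k _ (hle ℓ h1) _ (hle ℓ h1)
      have hk : (0 : ℝ) < 1 / (k + 1) := by positivity
      rw [or_self, edist_self, add_zero, ENNReal.ofReal_add hℓ hk.le] at h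
      rw [hF k ℓ h1, zero_add]
      exact (ENNReal.add_le_add_iff_left ENNReal.ofReal_ne_top).1 h
    have h := le_of_tendsto_of_tendsto' ((hlim ℓ).edist tendsto_const_nhds) (hzero 0) this
    rwa [ENNReal.ofReal_zero, nonpos_iff_eq_zero, edist_eq_zero] at h
  refine ⟨γ, hγ0, hγ1, ?_⟩
  -- A 1-Lipschitz curve on [0, ℓ] whose endpoints are at distance ℓ cannot lose distance anywhere.
  have hge : ∀ s ∈ Icc 0 ℓ, ∀ t ∈ Icc 0 ℓ, s ≤ t → edist (γ s) (γ t) = ENNReal.ofReal |s - t| := by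
    intro s hs t ht hst
    refine le_antisymm (hγle s hs t ht) ?_
    have h4 : ENNReal.ofReal ℓ ≤
        ENNReal.ofReal s + edist (γ s) (γ t) + ENNReal.ofReal (ℓ - t) := by
      rw [← hab]
      calc edist a b ≤ edist a (γ s) + edist (γ s) (γ t) + edist (γ t) b := edist_triangle4 _ _ _ _
        _ ≤ _ := by
          gcongr
          · have := hγle 0 h0 s hs
            rwa [hγ0, zero_sub, abs_neg, abs_of_nonneg hs.1] at this
          · have := hγle t ht ℓ h1
            rwa [hγ1, abs_sub_comm, abs_of_nonneg (by linarith [ht.2])] at this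
    rw [abs_sub_comm, abs_of_nonneg (by linarith)]
    have h5 : ENNReal.ofReal (s + (ℓ - t)) + ENNReal.ofReal (t - s)
        ≤ ENNReal.ofReal (s + (ℓ - t)) + edist (γ s) (γ t) := by
      rw [← ENNReal.ofReal_add (by linarith [hs.1, ht.2]) (by linarith)]
      rw [ENNReal.ofReal_add hs.1 (by linarith [ht.2])]
      convert! h4 using 1
      · congr 1; ring
      · ring
    exact (ENNReal.add_le_add_iff_left ENNReal.ofReal_ne_top).1 h5
  intro s hs t ht
  rcases le_total s t with h | h
  · exact hge s hs t ht h
  · rw [edist_comm, abs_sub_comm]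
    exact hge t ht s hs h

/-- A short map that can lift points at a prescribed distance and is locally injective is locally
isometric. -/
lemma exists_forall_edist_eq_of_lift {pr : X → Y} (hlip : ∀ a b, edist (pr a) (pr b) ≤ edist a b)
    (hlift : ∀ a y r, edist (pr a) y < r → ∃ b, pr b = y ∧ edist a b < r) {x : X} {V : Set X}
    (hV : V ∈ 𝓝 x) (hinj : InjOn pr V) :
    ∃ ε > 0, ∀ a ∈ Metric.eball x ε, ∀ b ∈ Metric.eball x ε, edist (pr a) (pr b) = edist a b := by
  obtain ⟨ε, hε, hεV⟩ := EMetric.mem_nhds_iff.1 hV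
  have hε3 : 0 < ε / 3 := ENNReal.div_pos hε.ne' (by simp)
  refine ⟨ε / 3, hε3, fun a ha b hb ↦ le_antisymm (hlip a b) ?_⟩
  have hab : edist a b < ε / 3 + ε / 3 :=
    (edist_triangle_right a b x).trans_lt (ENNReal.add_lt_add ha hb)
  by_contra! hlt
  obtain ⟨r, hr1, hr2⟩ := exists_between hlt
  -- A lift of `pr b` strictly closer to a than b would still lie in `V`, so injectivity identifies
  -- it with b.
  obtain ⟨b', hb', hb'r⟩ := hlift a (pr b) r hr1
  have hb'V : b' ∈ V := by
    apply hεV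
    rw [Metric.mem_eball, edist_comm]
    calc edist x b' ≤ edist x a + edist a b' := edist_triangle _ _ _
      _ < ε / 3 + (ε / 3 + ε / 3) := by
        rw [edist_comm x a]
        exact ENNReal.add_lt_add ha (hb'r.trans (hr2.trans hab))
      _ = ε := by rw [← add_assoc, ENNReal.add_thirds]
  have hbV : b ∈ V := hεV (lt_of_lt_of_le hb (ENNReal.div_le_of_le_mul (by
    calc ε = ε * 1 := (mul_one _).symm
      _ ≤ ε * 3 := by gcongr; norm_num)))
  rw [hinj hb'V hbV hb'] at hb'r
  exact absurd hb'r (not_lt.2 hr2.le)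

/-- If the total space of a short covering over a compact space has preconnected balls, then its
closed balls of some fixed radius are compact. -/
lemma IsCoveringMap.exists_isCompact_closedEBall [CompactSpace Y] {pr : X → Y}
    (hpr : IsCoveringMap pr) (hlip : ∀ a b, edist (pr a) (pr b) ≤ edist a b)
    (hX : HasPreconnectedBalls X) :
    ∃ ρ : ℝ≥0, 0 < ρ ∧ ∀ a : X, IsCompact (Metric.closedEBall a ρ) := by
  classical
  have hloc : ∀ y : Y, ∃ ρ : ℝ≥0, 0 < ρ ∧ ∀ a, pr a ∈ Metric.eball y ρ →
      IsCompact (Metric.closedEBall a ρ) := by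
    intro y
    obtain ⟨-, U, hyU, hU, -, H, hH⟩ := hpr y
    obtain ⟨ε, hε, hεU⟩ := EMetric.mem_nhds_iff.1 (hU.mem_nhds hyU)
    obtain ⟨δ, hδ0, hδ⟩ := ENNReal.lt_iff_exists_nnreal_btwn.1 hε
    have hδ0 : 0 < δ := by simpa using hδ0
    have hδ3 : 0 < δ / 3 := by positivity
    have hsum : ((δ / 3 : ℝ≥0) : ℝ≥0∞) + ((δ / 3 + δ / 3 : ℝ≥0) : ℝ≥0∞) = δ := by
      rw [← ENNReal.coe_add, ENNReal.coe_inj, ← add_assoc, ← NNReal.coe_inj]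
      push_cast; ring
    refine ⟨δ / 3, hδ3, fun a ha ↦ ?_⟩
    have hball : ∀ b ∈ Metric.eball a ((δ / 3 + δ / 3 : ℝ≥0) : ℝ≥0∞), pr b ∈ U := by
      intro b hb
      apply hεU
      rw [Metric.mem_eball] at ha hb ⊢
      calc edist (pr b) y ≤ edist (pr b) (pr a) + edist (pr a) y := edist_triangle _ _ _
        _ ≤ ((δ / 3 + δ / 3 : ℝ≥0) : ℝ≥0∞) + ((δ / 3 : ℝ≥0) : ℝ≥0∞) :=
            add_le_add ((hlip _ _).trans hb.le) ha.le
        _ = δ := by rw [add_comm, hsum]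
        _ < ε := hδ
    have hδlt : ((δ / 3 : ℝ≥0) : ℝ≥0∞) < ((δ / 3 + δ / 3 : ℝ≥0) : ℝ≥0∞) :=
      ENNReal.coe_lt_coe.2 (lt_add_of_pos_right _ hδ3)
    have haU : pr a ∈ U := hball a (Metric.mem_eball_self (by positivity))
    set i := (H ⟨a, haU⟩).2
    -- The local section along the sheet through a; its value outside `U` plays no role.
    set σ : Y → X := fun z ↦ if hz : z ∈ U then (H.symm (⟨z, hz⟩, i)).1 else a with hσ
    have hσU : ContinuousOn σ U := by
      rw [continuousOn_iff_continuous_domRestrict]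
      have : U.domRestrict σ = fun z : U ↦ (H.symm (z, i)).1 := by
        ext z
        simp [hσ]
      rw [this]
      exact continuous_subtype_val.comp (H.symm.continuous.comp (by fun_prop))
    have hprσ : ∀ z ∈ U, pr (σ z) = z := by
      intro z hz
      simp only [hσ, dif_pos hz]
      rw [← hH, H.apply_symm_apply]
    have hσa : σ (pr a) = a := by
      simp only [hσ, dif_pos haU]
      have : ((⟨pr a, haU⟩ : U), i) = H ⟨a, haU⟩ := Prod.ext (Subtype.ext (hH ⟨a, haU⟩).symm) rfl
      rw [this, H.symm_apply_apply]
    have hcpt : IsCompact (σ '' Metric.closedEBall (pr a) ((δ / 3 : ℝ≥0) : ℝ≥0∞)) := by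
      refine Metric.isClosed_closedEBall.isCompact.image_of_continuousOn (hσU.mono ?_)
      intro z hz
      apply hεU
      rw [Metric.mem_eball] at ha ⊢
      rw [Metric.mem_closedEBall] at hz
      calc edist z y ≤ edist z (pr a) + edist (pr a) y := edist_triangle _ _ _
        _ ≤ ((δ / 3 : ℝ≥0) : ℝ≥0∞) + ((δ / 3 + δ / 3 : ℝ≥0) : ℝ≥0∞) :=
            add_le_add hz (ha.le.trans hδlt.le)
        _ = δ := hsum
        _ < ε := hδ
    refine hcpt.of_isClosed_subset Metric.isClosed_closedEBall ?_
    intro b hb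
    rw [Metric.mem_closedEBall] at hb
    -- On `S` the identity and `σ ∘ pr` lift the same map and agree at a, so they agree at b: the
    -- ball lies in the image under `σ` of a compact ball.
    obtain ⟨S, hSball, hS, haS, hbS⟩ := hX a b _ (by rw [edist_comm]; exact hb.trans_lt hδlt)
    have heq := hpr.eqOn_of_comp_eqOn hS continuousOn_id
      (hσU.comp hpr.continuous.continuousOn fun c hc ↦ hball c (hSball hc))
      (fun c hc ↦ (hprσ _ (hball c (hSball hc))).symm) haS hσa.symm
    exact ⟨pr b, (hlip _ _).trans hb, (heq hbS).symm⟩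
  have key : ∃ ρ : ℝ≥0, 0 < ρ ∧ ∀ a : X, pr a ∈ univ → IsCompact (Metric.closedEBall a ρ) := by
    refine isCompact_univ.induction_on (p := fun S : Set Y ↦ ∃ ρ : ℝ≥0, 0 < ρ ∧ ∀ a : X, pr a ∈ S →
      IsCompact (Metric.closedEBall a ρ)) ⟨1, one_pos, by simp⟩ ?_ ?_ ?_
    · rintro S T hST ⟨ρ, hρ, h⟩
      exact ⟨ρ, hρ, fun a ha ↦ h a (hST ha)⟩
    · rintro S T ⟨ρ, hρ, h⟩ ⟨ρ', hρ', h'⟩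
      refine ⟨min ρ ρ', lt_min hρ hρ', ?_⟩
      rintro a (ha | ha)
      · exact (h a ha).of_isClosed_subset Metric.isClosed_closedEBall
          (Metric.closedEBall_subset_closedEBall (by simp))
      · exact (h' a ha).of_isClosed_subset Metric.isClosed_closedEBall
          (Metric.closedEBall_subset_closedEBall (by simp))
    · intro y _
      obtain ⟨ρ, hρ, h⟩ := hloc y
      exact ⟨Metric.eball y ρ, nhdsWithin_le_nhds (Metric.eball_mem_nhds _ (by simpa using hρ)),
        ρ, hρ, h⟩
  obtain ⟨ρ, hρ, h⟩ := key
  exact ⟨ρ, hρ, fun a ↦ h a (mem_univ _)⟩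

/-- A metric covering of a compact space is isometric at distances smaller than the injectivity
radius of the base. -/
theorem IsCoveringMap.edist_eq_of_lt_injectivityRadius [CompactSpace Y] {pr : X → Y}
    (hpr : IsCoveringMap pr) (hlip : ∀ a b, edist (pr a) (pr b) ≤ edist a b)
    (hlift : ∀ a y r, edist (pr a) y < r → ∃ b, pr b = y ∧ edist a b < r)
    (hX : HasAlmostGeodesics X) (hX' : HasPreconnectedBalls X) {a b : X}
    (hab : edist a b < injectivityRadius Y) : edist (pr a) (pr b) = edist a b := by
  obtain ⟨ρ, hρ, hc⟩ := hpr.exists_isCompact_closedEBall hlip hX'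
  have htop : edist a b ≠ ⊤ := hab.ne_top
  have hℓ : edist a b = ENNReal.ofReal (edist a b).toReal := (ENNReal.ofReal_toReal htop).symm
  set ℓ := (edist a b).toReal
  have hℓ0 : 0 ≤ ℓ := ENNReal.toReal_nonneg
  obtain ⟨γ, hγ0, hγ1, hγ⟩ := hX.exists_geodesic (hX.isCompact_closedEBall hρ hc) hℓ0 hℓ
  -- The projection is locally isometric, so the image of a minimizing geodesic still minimizes
  -- locally.
  have hgeod : IsUnitSpeedGeodesic (pr ∘ γ) ℓ := by
    intro t ht
    obtain ⟨e, het, heq⟩ := hpr.isLocalHomeomorph (γ t)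
    obtain ⟨ε, hε, hiso⟩ := exists_forall_edist_eq_of_lift hlip hlift
      (e.open_source.mem_nhds het) (heq ▸ e.injOn)
    obtain ⟨δ, hδ0, hδ⟩ := ENNReal.lt_iff_exists_nnreal_btwn.1 hε
    have hmem : ∀ s ∈ Icc 0 ℓ, |s - t| < δ → γ s ∈ Metric.eball (γ t) ε := by
      intro s hs hst
      rw [Metric.mem_eball, hγ s hs t ht]
      refine lt_of_le_of_lt ?_ hδ
      rw [← ENNReal.ofReal_coe_nnreal]
      exact ENNReal.ofReal_le_ofReal hst.le
    refine ⟨δ, by simpa using hδ0, fun s hs s' hs' hst hs't ↦ ?_⟩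
    rw [Function.comp_apply, Function.comp_apply, hiso _ (hmem s hs hst) _ (hmem s' hs' hs't)]
    exact hγ s hs s' hs'
  refine le_antisymm (hlip a b) ?_
  by_contra! hlt
  -- A strict loss of distance would make the projected curve one of the non-minimizing geodesics
  -- defining the injectivity radius.
  have : injectivityRadius Y ≤ edist a b :=
    sInf_le ⟨ℓ, pr ∘ γ, hℓ0, hgeod, by simpa [hγ0, hγ1, ← hℓ] using hlt, hℓ⟩
  exact absurd hab (not_lt.2 this)

end MetricGeometry

/-! ### Almost geodesics and balls in Riemannian manifolds -/

section RiemannianLength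

open Filter Topology

/-- On a path of length less than L from a to b, the intermediate value theorem picks a point at
each distance from a. These points need not occur in the order of their distances, hence the
alternative. -/
lemma hasAlmostGeodesics_of_isRiemannianManifold
    {E : Type*} [NormedAddCommGroup E] [NormedSpace ℝ E] {H : Type*} [TopologicalSpace H]
    (I : ModelWithCorners ℝ E H) {M : Type*} [EMetricSpace M] [ChartedSpace H M]
    [RiemannianBundle (fun x : M ↦ TangentSpace I x)] [IsRiemannianManifold I M] :
    HasAlmostGeodesics M := by
  intro a b L hL
  have hL' := hL
  rw [IsRiemannianManifold.out (I := I)] at hL'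
  obtain ⟨γ, hγ0, hγ1, hγ, hγL, -⟩ :=
    exists_lt_locally_constant_of_riemannianEDist_lt hL' zero_lt_one
  have hivt : ∀ s ≤ edist a b, ∃ t ∈ Icc (0 : ℝ) 1, edist a (γ t) = s := by
    intro s hs
    have hcont : ContinuousOn (fun t ↦ edist a (γ t)) (Icc 0 1) :=
      (continuous_const.edist hγ.continuous).continuousOn
    exact intermediate_value_Icc zero_le_one hcont ⟨by simp [hγ0], by simpa [hγ1]⟩
  choose! τ hτ hτs using hivt
  have key : ∀ s ≤ edist a b, ∀ t ≤ edist a b, τ s ≤ τ t →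
      s + edist (γ (τ s)) (γ (τ t)) + edist (γ (τ t)) b ≤ L := by
    intro s hs t ht hst
    have h1 := edist_le_pathELength I (hτ s hs).1 hγ.contMDiffOn
    have h2 := edist_le_pathELength I hst hγ.contMDiffOn
    have h3 := edist_le_pathELength I (hτ t ht).2 hγ.contMDiffOn
    rw [hγ0, hτs s hs] at h1
    rw [hγ1] at h3
    calc _ ≤ _ := add_le_add (add_le_add h1 h2) h3
      _ = pathELength I γ 0 1 := by
        rw [pathELength_add (hτ s hs).1 hst, pathELength_add (hτ t ht).1 (hτ t ht).2]
      _ ≤ L := hγL.le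
  refine ⟨fun s ↦ γ (τ s), hτs, fun s hs t ht ↦ ?_⟩
  rcases le_total (τ s) (τ t) with h | h
  · exact Or.inl (key s hs t ht h)
  · right
    rw [edist_comm (γ (τ s))]
    exact key t ht s hs h

/-- A path of length less than r never leaves the ball of radius r about its origin. -/
lemma hasPreconnectedBalls_of_isRiemannianManifold
    {E : Type*} [NormedAddCommGroup E] [NormedSpace ℝ E] {H : Type*} [TopologicalSpace H]
    (I : ModelWithCorners ℝ E H) {M : Type*} [EMetricSpace M] [ChartedSpace H M]
    [RiemannianBundle (fun x : M ↦ TangentSpace I x)] [IsRiemannianManifold I M] :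
    HasPreconnectedBalls M := by
  intro a b r hr
  rw [IsRiemannianManifold.out (I := I)] at hr
  obtain ⟨γ, hγ0, hγ1, hγ, hγr, -⟩ :=
    exists_lt_locally_constant_of_riemannianEDist_lt hr zero_lt_one
  refine ⟨γ '' Icc 0 1, ?_, isPreconnected_Icc.image _ hγ.continuous.continuousOn,
    ⟨0, by simp, hγ0⟩, ⟨1, by simp, hγ1⟩⟩
  rintro _ ⟨t, ht, rfl⟩
  rw [Metric.mem_eball, edist_comm]
  have h := edist_le_pathELength I ht.1 hγ.contMDiffOn
  rw [hγ0] at h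
  exact (h.trans (pathELength_mono le_rfl ht.2)).trans_lt hγr

end RiemannianLength

/-! ### Riemannian coverings preserve small distances -/

section RiemannianCovering

open Filter Topology

/-- The inverse function theorem on manifolds: a smooth map with injective derivative, between
manifolds of the same dimension, has a smooth local left inverse. -/
lemma ContMDiffAt.exists_eventually_leftInverse {n : ℕ} {N N' : Type*} [TopologicalSpace N]
    [ChartedSpace (EuclideanSpace ℝ (Fin n)) N] [IsManifold (𝓡 n) 1 N] [TopologicalSpace N']
    [ChartedSpace (EuclideanSpace ℝ (Fin n)) N'] [IsManifold (𝓡 n) 1 N'] {f : N' → N} {y : N'}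
    (hf : ContMDiffAt (𝓡 n) (𝓡 n) 1 f y)
    (hinj : Function.Injective (mfderiv (𝓡 n) (𝓡 n) f y)) :
    ∃ g : N → N', ContMDiffAt (𝓡 n) (𝓡 n) 1 g (f y) ∧ ∀ᶠ z in 𝓝 y, g (f z) = z := by
  set F := writtenInExtChartAt (𝓡 n) (𝓡 n) y f with hF
  set x := extChartAt (𝓡 n) y y with hx
  have hFs : ContDiffAt ℝ 1 F x := by
    have := (contMDiffAt_iff.1 hf).2
    simp only [ModelWithCorners.range_eq_univ, contDiffWithinAt_univ] at this
    exact this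
  have hder : mfderiv (𝓡 n) (𝓡 n) f y = fderiv ℝ F x := by
    rw [(hf.mdifferentiableAt one_ne_zero).mfderiv]
    simp only [ModelWithCorners.range_eq_univ, fderivWithin_univ]
    rfl
  rw [hder] at hinj
  -- Equal dimensions turn injectivity of the derivative into invertibility.
  let e : EuclideanSpace ℝ (Fin n) ≃L[ℝ] EuclideanSpace ℝ (Fin n) :=
    (LinearEquiv.ofInjectiveEndo (fderiv ℝ F x : _ →ₗ[ℝ] _) hinj).toContinuousLinearEquiv
  have he : HasFDerivAt F (e : EuclideanSpace ℝ (Fin n) →L[ℝ] EuclideanSpace ℝ (Fin n)) x :=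
    (hFs.differentiableAt one_ne_zero).hasFDerivAt
  set G := hFs.localInverse he one_ne_zero with hG
  have hGs : ContDiffAt ℝ 1 G (F x) := hFs.to_localInverse he one_ne_zero
  have hFx : F x = extChartAt (𝓡 n) (f y) (f y) := by
    simp [hF, hx, writtenInExtChartAt]
  have hGx : G (F x) = x := hFs.localInverse_apply_image he one_ne_zero
  have hGev : ∀ᶠ v in 𝓝 x, G (F v) = v :=
    (hFs.hasStrictFDerivAt' he one_ne_zero).eventually_left_inverse
  refine ⟨fun z ↦ (extChartAt (𝓡 n) y).symm (G (extChartAt (𝓡 n) (f y) z)), ?_, ?_⟩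
  · have h1 : ContMDiffAt (𝓡 n) 𝓘(ℝ, EuclideanSpace ℝ (Fin n)) 1
        (fun z ↦ G (extChartAt (𝓡 n) (f y) z)) (f y) := by
      refine ContMDiffAt.comp (f y) (g := G) ?_ contMDiffAt_extChartAt
      rw [← hFx]
      exact hGs.contMDiffAt
    refine ContMDiffAt.comp (f y) (g := (extChartAt (𝓡 n) y).symm) ?_ h1
    rw [← hFx, hGx, hx]
    exact (contMDiffOn_extChartAt_symm y).contMDiffAt (extChartAt_target_mem_nhds y)
  · filter_upwards [(continuousAt_extChartAt (I := 𝓡 n) y).eventually hGev,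
      extChartAt_source_mem_nhds (I := 𝓡 n) y] with z hz hzs
    simp only [hF, writtenInExtChartAt, Function.comp_apply,
      (extChartAt (𝓡 n) y).left_inv hzs] at hz
    rw [hz, (extChartAt (𝓡 n) y).left_inv hzs]

variable {n : ℕ} {N : Type*} [EMetricSpace N] [ChartedSpace (EuclideanSpace ℝ (Fin n)) N]
  [RiemannianBundle (fun y : N ↦ TangentSpace (𝓡 n) y)]
  {N' : Type*} [EMetricSpace N'] [ChartedSpace (EuclideanSpace ℝ (Fin n)) N']
  [RiemannianBundle (fun y : N' ↦ TangentSpace (𝓡 n) y)]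
  {proj : N' → N}

namespace IsRiemannianCovering

lemma enorm_mfderiv (h : IsRiemannianCovering n proj) (y : N') (v : TangentSpace (𝓡 n) y) :
    ‖mfderiv (𝓡 n) (𝓡 n) proj y v‖ₑ = ‖v‖ₑ := by
  rw [← ofReal_norm, ← ofReal_norm, norm_eq_sqrt_real_inner, norm_eq_sqrt_real_inner (x := v),
    h.inner_mfderiv]

lemma injective_mfderiv (h : IsRiemannianCovering n proj) (y : N') :
    Function.Injective (mfderiv (𝓡 n) (𝓡 n) proj y) := by
  refine (injective_iff_map_eq_zero _).2 fun v hv ↦ ?_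
  have := h.inner_mfderiv y v v
  rw [hv, inner_zero_left] at this
  exact inner_self_eq_zero.1 this.symm

lemma pathELength_comp (h : IsRiemannianCovering n proj) {γ : ℝ → N'} {a b : ℝ}
    (hγ : ContMDiffOn 𝓘(ℝ, ℝ) (𝓡 n) 1 γ (Icc a b)) :
    pathELength (𝓡 n) (proj ∘ γ) a b = pathELength (𝓡 n) γ a b := by
  rw [pathELength_eq_lintegral_mfderiv_Ioo, pathELength_eq_lintegral_mfderiv_Ioo]
  refine setLIntegral_congr_fun measurableSet_Ioo fun t ht ↦ ?_
  have hd : MDifferentiableAt 𝓘(ℝ, ℝ) (𝓡 n) γ t :=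
    (hγ.contMDiffAt (Icc_mem_nhds ht.1 ht.2)).mdifferentiableAt one_ne_zero
  have h1 : mfderiv 𝓘(ℝ, ℝ) (𝓡 n) (proj ∘ γ) t =
      (mfderiv (𝓡 n) (𝓡 n) proj (γ t)) ∘L (mfderiv 𝓘(ℝ, ℝ) (𝓡 n) γ t) :=
    mfderiv_comp t ((h.contMDiff (γ t)).mdifferentiableAt (by simp)) hd
  have h2 : mfderiv 𝓘(ℝ, ℝ) (𝓡 n) (proj ∘ γ) t 1 =
      mfderiv (𝓡 n) (𝓡 n) proj (γ t) (mfderiv 𝓘(ℝ, ℝ) (𝓡 n) γ t 1) := congr($h1 1)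
  rw [h2]
  exact h.enorm_mfderiv _ _

lemma edist_le [IsRiemannianManifold (𝓡 n) N] [IsRiemannianManifold (𝓡 n) N']
    (h : IsRiemannianCovering n proj) (a b : N') : edist (proj a) (proj b) ≤ edist a b := by
  refine le_of_forall_gt fun L hL ↦ ?_
  rw [IsRiemannianManifold.out (I := 𝓡 n)] at hL
  obtain ⟨γ, hγ0, hγ1, hγ, hγL, -⟩ :=
    exists_lt_locally_constant_of_riemannianEDist_lt hL zero_lt_one
  have h1 := edist_le_pathELength (𝓡 n) zero_le_one
    ((h.contMDiff.of_le (by simp)).comp hγ).contMDiffOn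
  rw [h.pathELength_comp hγ.contMDiffOn, Function.comp_apply, Function.comp_apply, hγ0, hγ1] at h1
  exact h1.trans_lt hγL

/-- Lift a nearly minimizing path. The lift is C^1 because the projection has C^1 local left
inverses, and it has the same length because the metric is preserved. -/
lemma exists_lift [IsManifold (𝓡 n) 1 N] [IsManifold (𝓡 n) 1 N'] [IsRiemannianManifold (𝓡 n) N]
    [IsRiemannianManifold (𝓡 n) N'] (h : IsRiemannianCovering n proj) (a : N') (y : N) (r : ℝ≥0∞)
    (hr : edist (proj a) y < r) : ∃ b, proj b = y ∧ edist a b < r := by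
  rw [IsRiemannianManifold.out (I := 𝓡 n)] at hr
  obtain ⟨γ, hγ0, hγ1, hγ, hγr, -⟩ :=
    exists_lt_locally_constant_of_riemannianEDist_lt hr zero_lt_one
  obtain ⟨Γ₀, hΓ₀, hΓ₀0⟩ := h.isCoveringMap.exists_path_lifts
    ⟨fun t : unitInterval ↦ γ t, hγ.continuous.comp continuous_subtype_val⟩ a (by simpa using hγ0)
  set Γ : ℝ → N' := Γ₀ ∘ projIcc 0 1 zero_le_one with hΓ
  have hlift : EqOn (proj ∘ Γ) γ (Icc 0 1) := by
    intro t ht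
    have := congr_fun hΓ₀ (projIcc 0 1 zero_le_one t)
    simpa [hΓ, projIcc_of_mem _ ht] using this
  have hcont : Continuous Γ := Γ₀.continuous.comp continuous_projIcc
  have hsmooth : ContMDiffOn 𝓘(ℝ, ℝ) (𝓡 n) 1 Γ (Icc 0 1) := by
    intro t ht
    obtain ⟨g, hg, hgev⟩ := ContMDiffAt.exists_eventually_leftInverse
      ((h.contMDiff (Γ t)).of_le (by simp)) (h.injective_mfderiv (Γ t))
    have h1 : ContMDiffWithinAt 𝓘(ℝ, ℝ) (𝓡 n) 1 (proj ∘ Γ) (Icc 0 1) t :=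
      hγ.contMDiffOn.congr hlift t ht
    have h2 : ContMDiffWithinAt 𝓘(ℝ, ℝ) (𝓡 n) 1 (g ∘ (proj ∘ Γ)) (Icc 0 1) t :=
      hg.comp_contMDiffWithinAt t h1
    refine h2.congr_of_eventuallyEq ?_ hgev.self_of_nhds.symm
    filter_upwards [nhdsWithin_le_nhds (hcont.continuousAt.eventually hgev)] with s hs
    exact hs.symm
  have hΓ0 : Γ 0 = a := by simpa [hΓ] using hΓ₀0
  refine ⟨Γ 1, (hlift (right_mem_Icc.2 zero_le_one)).trans hγ1, ?_⟩
  have h1 := edist_le_pathELength (𝓡 n) zero_le_one hsmooth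
  rw [← h.pathELength_comp hsmooth, pathELength_congr hlift, hΓ0] at h1
  exact h1.trans_lt hγr

theorem edist_eq_of_lt_injectivityRadius [IsManifold (𝓡 n) 1 N] [IsManifold (𝓡 n) 1 N']
    [IsRiemannianManifold (𝓡 n) N] [IsRiemannianManifold (𝓡 n) N'] [CompactSpace N]
    (h : IsRiemannianCovering n proj) {a b : N'} (hab : edist a b < injectivityRadius N) :
    edist (proj a) (proj b) = edist a b :=
  h.isCoveringMap.edist_eq_of_lt_injectivityRadius h.edist_le h.exists_lift
    (hasAlmostGeodesics_of_isRiemannianManifold (𝓡 n))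
    (hasPreconnectedBalls_of_isRiemannianManifold (𝓡 n)) hab

end IsRiemannianCovering

end RiemannianCovering

/-! ### The estimate for liftings -/

theorem theorem1p4
    -- `M`: a compact smooth Riemannian manifold of dimension `m`, possibly with boundary
    {m : ℕ} {H : Type*} [TopologicalSpace H] (I : ModelWithCorners ℝ (EuclideanSpace ℝ (Fin m)) H)
    {M : Type*} [EMetricSpace M] [ChartedSpace H M] [IsManifold I ∞ M]
    [RiemannianBundle (fun x : M ↦ TangentSpace I x)]
    [IsContMDiffRiemannianBundle I ∞ (EuclideanSpace ℝ (Fin m)) (fun x : M ↦ TangentSpace I x)]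
    [IsRiemannianManifold I M] [CompactSpace M] [MeasurableSpace M] [BorelSpace M]
    -- `N`: a compact smooth Riemannian manifold of dimension `n`
    {n : ℕ} {N : Type*} [EMetricSpace N] [ChartedSpace (EuclideanSpace ℝ (Fin n)) N]
    [IsManifold (𝓡 n) ∞ N] [RiemannianBundle (fun y : N ↦ TangentSpace (𝓡 n) y)]
    [IsContMDiffRiemannianBundle (𝓡 n) ∞ (EuclideanSpace ℝ (Fin n))
      (fun y : N ↦ TangentSpace (𝓡 n) y)]
    [IsRiemannianManifold (𝓡 n) N] [CompactSpace N] [MeasurableSpace N] [BorelSpace N]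
    -- `N'`: a smooth Riemannian manifold, covering `N`
    {N' : Type*} [EMetricSpace N'] [SecondCountableTopology N']
    [ChartedSpace (EuclideanSpace ℝ (Fin n)) N']
    [IsManifold (𝓡 n) ∞ N'] [RiemannianBundle (fun y : N' ↦ TangentSpace (𝓡 n) y)]
    [IsContMDiffRiemannianBundle (𝓡 n) ∞ (EuclideanSpace ℝ (Fin n))
      (fun y : N' ↦ TangentSpace (𝓡 n) y)]
    [IsRiemannianManifold (𝓡 n) N'] [MeasurableSpace N'] [BorelSpace N']
    (proj : N' → N) (hproj : IsRiemannianCovering n proj)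
    (s p : ℝ) (hs : s ∈ Ioo (0 : ℝ) 1) (hp : 1 < p) (hsp : 1 < s * p) :
    ∃ C : ℝ≥0, 0 < C ∧ ∀ u' : M → N',
      MemLiftingSpace N m u' → MemFracSobolev m s p (proj ∘ u') →
        truncatedEnergy m s p u' ≤ C * gagliardoEnergy m s p (proj ∘ u') := by
  have : IsContinuousRiemannianBundle (EuclideanSpace ℝ (Fin m)) (fun x : M ↦ TangentSpace I x) := by
    obtain ⟨g, hg, hinner⟩ := IsContMDiffRiemannianBundle.exists_contMDiff (IB := I) (n := ∞)
      (F := EuclideanSpace ℝ (Fin m)) (E := fun x : M ↦ TangentSpace I x)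
    exact ⟨g, hg.continuous, hinner⟩
  have : IsManifold I 1 M := .of_le (n := ∞) (by simp)
  have : IsManifold (𝓡 n) 1 N := .of_le (n := ∞) (by simp)
  have : IsManifold (𝓡 n) 1 N' := .of_le (n := ∞) (by simp)
  have : SecondCountableTopology N := EMetric.secondCountable_of_sigmaCompact N
  obtain ⟨C, hC⟩ := exists_truncatedEnergy_le I (M := M) (Y := N) (Y' := N') hp hsp
    (injectivityRadius N / 2)
  -- Adding 1 makes the constant positive.
  refine ⟨C + 1, by positivity, fun u' hu' _ ↦ ?_⟩
  obtain ⟨hmeas, hX⟩ := hu'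
  -- The estimate is stated for measurable maps; passing to a measurable representative changes none
  -- of the three double integrals.
  set u := hmeas.mk u' with hu
  have hae : u' =ᵐ[μHE[m]] u := hmeas.ae_eq_mk
  have hum : Measurable u := hmeas.measurable_mk
  have hX' : ∫⁻ x, ∫⁻ y in {y | injectivityRadius N / 2 ≤ edist (u x) (u y)},
      1 / edist x y ^ ((m : ℝ) + 1) ∂μHE[m] ∂μHE[m] < ⊤ := by
    refine lt_of_le_of_lt (le_of_eq (lintegral_congr_ae ?_)) hX
    filter_upwards [hae] with x hx
    refine setLIntegral_congr ?_
    filter_upwards [hae] with y hy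
    apply propext
    change _ ≤ edist (u x) (u y) ↔ _ ≤ edist (u' x) (u' y)
    rw [hx, hy]
  have htrunc : truncatedEnergy m s p u' = truncatedEnergy m s p u := by
    refine lintegral_congr_ae ?_
    filter_upwards [hae] with x hx
    refine lintegral_congr_ae ?_
    filter_upwards [hae] with y hy
    rw [hx, hy]
  have hgag : gagliardoEnergy m s p (proj ∘ u') = gagliardoEnergy m s p (proj ∘ u) := by
    refine lintegral_congr_ae ?_
    filter_upwards [hae] with x hx
    refine lintegral_congr_ae ?_
    filter_upwards [hae] with y hy
    rw [Function.comp_apply, Function.comp_apply, Function.comp_apply, Function.comp_apply, hx, hy]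
  rw [htrunc, hgag]
  refine (hC u (proj ∘ u) hum (hproj.isCoveringMap.continuous.measurable.comp hum)
    (fun x y hxy ↦ ?_) hX').trans ?_
  · exact hproj.edist_eq_of_lt_injectivityRadius (hxy.trans_le ENNReal.half_le_self)
  · gcongr
    exact le_self_add
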